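/- Let $G$ and $H$ be locally compact, second countable Hausdorff groups, with $G$ unimodular and with a fixed Haar measure $m_G$. Let $U\subseteq G\times H$ be open with $e\in U$ and let $K\subseteq G\times H$ be compact. A non-empty set $D\subseteq G\times H$ is a $(U,K)$-Delone set if $\#(gU\cap D)\le 1$ for all $g\in G\times H$ and $D\cdot K=G\times H$. Let $\mathcal D$ be the set of all $(U,K)$-Delone sets, with the topology induced by the Chabauty–Fell topology on the closed subsets of $G\times H$. (The Chabauty–Fell topology on the closed subsets of a space $Z$ is generated by the sets $\{Y : Y\cap C=\emptyset\}$ with $C\subseteq Z$ compact and $\{Y : Y\cap O\neq\emptyset\}$ with $O\subseteq Z$ open.) Let $\mathcal I$ be the set of all non-empty, closed, $G\times H$-invariant subsets of $\mathcal D$, with the Chabauty–Fell topology on the closed subsets of $\mathcal D$. The group $G$ acts on $\mathcal D$ by $gD:=(g,e_H)D$. Let $\vartheta:H\to[0,\infty)$ be continuous with compact support. For $D\in\mathcal D$ let $\ell^2(D,\vartheta)$ be the Hilbert space with inner product $\langle u,v\rangle_{D,\vartheta}=\sum_{x\in D}\overline{u(x)}\,v(x)\,\vartheta(\pi_H(x))$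 (functions that agree wherever $\vartheta\circ\pi_H\neq 0$ are identified), and let $\delta_x$ be the function that is $1$ at $x$ and $0$ elsewhere. Let $X$ be the set of all $(x,D,y)$ with $D\in\mathcal D$ and $x,y\in D\cap (G\times\operatorname{supp}\vartheta)$. A kernel of finite type is a bounded continuous $a:X\to\mathbb C$ with $a(gx,gD,gy)=a(x,D,y)$ for all $g\in G$, for which there is a compact $K_a=K_a^{-1}\subseteq G$ with $a(x,D,y)=0$ whenever $\pi_G(x^{-1}y)\notin K_a$. It acts on $\ell^2(D,\vartheta)$ by $(\lambda^D(a)u)(x)=\sum_{y\in D}a(x,D,y)\,u(y)\,\vartheta(\pi_H(y))$. The kernels of finite type form a $*$-algebra, and its completion in the norm $\|a\|=\sup_{D\in\mathcal D}\|\lambda^D(a)\|$ is a $C^*$-algebra. A random bounded operator is a family $A=(A_D)_{D\in\mathcal D}=(\lambda^D(a))_{D\in\mathcal D}$ with $a$ in this completion, that is, a limit, uniformly in $D\in\mathcal D$ in operator norm, of families $(\lambda^D(a_n))_D$ with $a_n$ of finite type. For $\Omega\in\mathcal I$, a $G$-invariant Borel probability measure $\mu$ on $\Omega$, and a self-adjoint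 random bounded operator $A$, the weighted density of states $\eta^A_{\Omega,\vartheta,\mu}$ is the Radon measure on $\mathbb R$ with $$\eta^A_{\Omega,\vartheta,\mu}(\phi)=\int_\Omega\sum_{x\in D}\rho(\pi_G(x))\,\langle\delta_x,\phi(A_D)\delta_x\rangle_{D,\vartheta}\,d\mu(D),\qquad \phi\in C_c(\mathbb R),$$ for every non-negative $\rho\in C_c(G)$ with $\int_G\rho\,dm_G=1$. Theorem. Let $\Omega\in\mathcal I$ be uniquely ergodic, that is, let $\mu$ be the only $G$-invariant Borel probability measure on $\Omega$. Let $\Omega_l\in\mathcal I$, $l\in\mathbb N$, be such that $\Omega_l\to\Omega$ in the Chabauty–Fell topology, and let $\mu_l$ be a $G$-invariant Borel probability measure on $\Omega_l$ for each $l$. Then for every self-adjoint random bounded operator $A$ the densities of states $\eta^A_{\Omega,\vartheta,\mu}$ and $\eta^A_{\Omega_l,\vartheta,\mu_l}$ exist and are unique (in particular they do not depend on $\rho$), and $\eta^A_{\Omega_l,\vartheta,\mu_l}\to\eta^A_{\Omega,\vartheta,\mu}$ in the weak-$*$ topology: $\lim_{l\to\infty}\eta^A_{\Omega_l,\vartheta,\mu_l}(\phi)=\eta^A_{\Omega,\vartheta,\mu}(\phi)$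 for all $\phi\in C_c(\mathbb R)$. -/

import Mathlib

open MeasureTheory Filter Topology Set
open scoped Pointwise ENNReal

noncomputable section

namespace DeloneDOS

/-! ### The Chabauty–Fell topology -/

/-- The set of all closed subsets of `Z` (including the empty set), to be endowed with the
Chabauty–Fell topology. -/
def FellSpace (Z : Type*) [TopologicalSpace Z] : Type _ := {F : Set Z // IsClosed F}

/-- The Chabauty–Fell topology: it is generated by the sets of all closed `F` that miss a given
compact set, and the sets of all closed `F` that hit a given open set. The finite intersections
of these sets are the usual basic sets
`{F | F ∩ C = ∅ and F ∩ O ≠ ∅ for all O in a finite family of open sets}`. -/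
instance FellSpace.instTopologicalSpace (Z : Type*) [TopologicalSpace Z] :
    TopologicalSpace (FellSpace Z) :=
  TopologicalSpace.generateFrom
    ({V | ∃ C : Set Z, IsCompact C ∧ V = {F : FellSpace Z | F.1 ∩ C = ∅}} ∪
     {V | ∃ O : Set Z, IsOpen O ∧ V = {F : FellSpace Z | (F.1 ∩ O).Nonempty}})

/-! ### Delone sets -/

/-- `D` is a `(U, K)`-Delone set in the group `X`: it is non-empty, every left translate of `U`
contains at most one point of `D`, and `D * K` is the whole group. -/
structure IsDelone {X : Type*} [Group X] (U K D : Set X) : Prop where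
  nonempty : D.Nonempty
  unifDiscrete : ∀ g : X, ((g • U) ∩ D).Subsingleton
  relDense : D * K = univ

theorem IsDelone.smul {X : Type*} [Group X] {U K : Set X} {D : Set X} (h : IsDelone U K D) (g : X) : IsDelone U K (g • D) where
  nonempty := h.nonempty.smul_set
  unifDiscrete k := by
    have h1 : (k • U) ∩ (g • D) = g • (((g⁻¹ * k) • U) ∩ D) := by
      rw [Set.smul_set_inter, smul_smul, mul_inv_cancel_left]
    rw [h1]
    exact (h.unifDiscrete _).image _
  relDense := by
    rw [smul_mul_assoc, h.relDense, Set.smul_set_univ]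

/-- The space of all `(U, K)`-Delone sets in `X`. (For non-empty open `U` a `U`-left uniformly
discrete set is automatically closed, so that closedness is no restriction.) -/
def DeloneSpace {X : Type*} [Group X] [TopologicalSpace X] (U K : Set X) : Type _ :=
  {D : FellSpace X // IsDelone U K D.1}

section Delone

variable {X : Type*} [Group X] [TopologicalSpace X] {U K : Set X}

/-- The Chabauty–Fell topology on the space of Delone sets. -/
instance : TopologicalSpace (DeloneSpace U K) :=
  inferInstanceAs (TopologicalSpace {D : FellSpace X // IsDelone U K D.1})

/-- The Borel σ-algebra of the Chabauty–Fell topology. -/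
instance : MeasurableSpace (DeloneSpace U K) := borel _

instance : BorelSpace (DeloneSpace U K) := ⟨rfl⟩

/-- The underlying subset of the group. -/
def DeloneSpace.carrier (D : DeloneSpace U K) : Set X := D.1.1

/-- The translation action `D ↦ g D` of the group on its Delone sets. -/
def DeloneSpace.translate [IsTopologicalGroup X] (g : X) (D : DeloneSpace U K) :
    DeloneSpace U K :=
  ⟨⟨g • D.1.1, D.1.2.smul g⟩, D.2.smul g⟩

end Delone

/-! ### Delone dynamical systems over `G × H`

The group `G` acts on the Delone sets in `G × H` by `g D := (g, 1) D`. -/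

section Systems

variable {G H : Type*} [Group G] [TopologicalSpace G] [IsTopologicalGroup G]
  [Group H] [TopologicalSpace H] [IsTopologicalGroup H] {U K : Set (G × H)}

/-- A closed set `Ω` of Delone sets is a Delone hull, if it is non-empty and invariant under
translation by `G × H`. -/
structure IsInvariantSystem (Ω : FellSpace (DeloneSpace U K)) : Prop where
  nonempty : Ω.1.Nonempty
  invariant : ∀ (g : G × H), ∀ D ∈ Ω.1, D.translate g ∈ Ω.1

/-- `μ` is a `G`-invariant Borel probability measure on `Ω`, regarded as a measure on the space
of all Delone sets. -/
structure IsInvariantProbability (Ω : FellSpace (DeloneSpace U K))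
    (μ : Measure (DeloneSpace U K)) : Prop where
  isProbability : IsProbabilityMeasure μ
  concentrated : μ Ω.1ᶜ = 0
  invariant : ∀ g : G, μ.map (fun D => D.translate (g, (1 : H))) = μ

/-- `(Ω, G)` is uniquely ergodic, with `μ` its only `G`-invariant Borel probability measure. -/
def IsUniquelyErgodicWith (Ω : FellSpace (DeloneSpace U K))
    (μ : Measure (DeloneSpace U K)) : Prop :=
  IsInvariantProbability Ω μ ∧ ∀ ν, IsInvariantProbability Ω ν → ν = μ

end Systems

/-! ### The weighted Hilbert spaces -/

section Hilbert

variable {G H : Type*} [Group G] [TopologicalSpace G] [MeasurableSpace G]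
  [Group H] [TopologicalSpace H] [MeasurableSpace H] {U K : Set (G × H)}

/-- The weighted counting measure `∑ x ∈ D, ϑ(π_H x) δ_x` of a Delone set `D`. -/
def weightedCount (ϑ : H → ℝ) (D : DeloneSpace U K) : Measure (G × H) :=
  Measure.sum fun x : D.carrier => ENNReal.ofReal (ϑ x.1.2) • Measure.dirac x.1

/-- The Hilbert space `ℓ²(D, ϑ)` with inner product `∑ x ∈ D, conj (u x) * v x * ϑ(π_H x)`.
Functions are identified if they agree at all points of `D` of non-zero weight. -/
abbrev WeightedL2 (ϑ : H → ℝ) (D : DeloneSpace U K) : Type _ :=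
  Lp ℂ 2 (weightedCount ϑ D)

variable [MeasurableSingletonClass G] [MeasurableSingletonClass H]

theorem weightedCount_singleton_ne_top (ϑ : H → ℝ) (D : DeloneSpace U K) (x : G × H) :
    weightedCount ϑ D {x} ≠ ∞ := by
  classical
  rw [weightedCount, Measure.sum_apply _ (measurableSet_singleton x)]
  by_cases hx : x ∈ D.carrier
  · rw [tsum_eq_single (⟨x, hx⟩ : D.carrier)]
    · simp
    · intro y hy
      have hne : y.1 ≠ x := fun h => hy (Subtype.ext h)
      simp [hne]
  · have h0 : ∀ y : D.carrier,
        (ENNReal.ofReal (ϑ y.1.2) • Measure.dirac y.1 : Measure (G × H)) {x} = 0 := by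
      intro y
      have hne : y.1 ≠ x := fun h => hx (h ▸ y.2)
      simp [hne]
    simp [h0]

/-- The function `δ_x` (equal to `1` at `x` and to `0` elsewhere) as an element of `ℓ²(D, ϑ)`. -/
def delta (ϑ : H → ℝ) (D : DeloneSpace U K) (x : G × H) : WeightedL2 ϑ D :=
  indicatorConstLp 2 (measurableSet_singleton x) (weightedCount_singleton_ne_top ϑ D x) (1 : ℂ)

end Hilbert

/-! ### Random bounded operators -/

section Operators

variable {G H : Type*} [Group G] [TopologicalSpace G] [IsTopologicalGroup G]
  [MeasurableSpace G] [Group H] [TopologicalSpace H] [IsTopologicalGroup H]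
  [MeasurableSpace H] {U K : Set (G × H)}

/-- The set of all `(x, D, y)` with `D` a Delone set and `x, y ∈ D ∩ (G × supp ϑ)`. -/
def kernelDomain (U K : Set (G × H)) (ϑ : H → ℝ) :
    Set ((G × H) × DeloneSpace U K × (G × H)) :=
  {p | p.1 ∈ p.2.1.carrier ∧ p.2.2 ∈ p.2.1.carrier ∧ p.1.2 ∈ tsupport ϑ ∧ p.2.2.2 ∈ tsupport ϑ}

/-- Kernels of finite type: continuous, bounded, `G`-invariant functions on `kernelDomain` with
finite range. Only the values of `a` on `kernelDomain` matter. -/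
structure IsFiniteTypeKernel (ϑ : H → ℝ)
    (a : (G × H) × DeloneSpace U K × (G × H) → ℂ) : Prop where
  continuousOn : ContinuousOn a (kernelDomain U K ϑ)
  bounded : ∃ C : ℝ, ∀ p ∈ kernelDomain U K ϑ, ‖a p‖ ≤ C
  finiteRange : ∃ Ka : Set G, IsCompact Ka ∧ Ka⁻¹ = Ka ∧
    ∀ p ∈ kernelDomain U K ϑ, (p.1⁻¹ * p.2.2).1 ∉ Ka → a p = 0
  invariant : ∀ g : G, ∀ x D y, (x, D, y) ∈ kernelDomain U K ϑ →
    a ((g, (1 : H)) * x, D.translate (g, (1 : H)), (g, (1 : H)) * y) = a (x, D, y)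

/-- `T` is the operator `λ^D(a)` on `ℓ²(D, ϑ)` with kernel `a`, that is
`(T u)(x) = ∑ y ∈ D, a(x, D, y) u(y) ϑ(π_H y)` for all `x ∈ D` of non-zero weight. (For a kernel
of finite type this is a finite sum, and there is exactly one such bounded operator.) -/
def HasKernel (ϑ : H → ℝ) (a : (G × H) × DeloneSpace U K × (G × H) → ℂ) (D : DeloneSpace U K)
    (T : WeightedL2 ϑ D →L[ℂ] WeightedL2 ϑ D) : Prop :=
  ∀ u : WeightedL2 ϑ D, (T u : G × H → ℂ) =ᵐ[weightedCount ϑ D]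
    fun x => ∫ y, a (x, D, y) * u y ∂(weightedCount ϑ D)

/-- Random bounded operators. The C*-algebra of the weight `ϑ` is the completion of the
*-algebra of kernels of finite type with respect to the norm `‖a‖ = sup_D ‖λ^D(a)‖`. As
`a ↦ (λ^D(a))_D` is isometric into the (complete) C*-algebra of bounded families of operators
with the supremum norm, the completion is realized as the closure of its range: the families
`(A_D)_D` that are limits, uniformly in all Delone sets `D`, of families `(λ^D(a))_D` with `a` of
finite type. -/
def IsRandomBoundedOperator (ϑ : H → ℝ)
    (A : ∀ D : DeloneSpace U K, WeightedL2 ϑ D →L[ℂ] WeightedL2 ϑ D) : Prop :=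
  ∀ ε > (0 : ℝ), ∃ (a : (G × H) × DeloneSpace U K × (G × H) → ℂ)
    (B : ∀ D : DeloneSpace U K, WeightedL2 ϑ D →L[ℂ] WeightedL2 ϑ D),
    IsFiniteTypeKernel ϑ a ∧ (∀ D, HasKernel ϑ a D (B D)) ∧ ∀ D, ‖A D - B D‖ ≤ ε

end Operators

/-! ### The weighted density of states -/

/-- The operator `φ(T)`, given by the continuous functional calculus of the self-adjoint bounded
operator `T` on a Hilbert space. -/
def functionalCalculus {E : Type*} [NormedAddCommGroup E] [InnerProductSpace ℂ E]
    [CompleteSpace E] (φ : ℝ → ℝ) (T : E →L[ℂ] E) : E →L[ℂ] E :=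
  cfc φ T

section DOS

variable {G H : Type*} [Group G] [TopologicalSpace G] [MeasurableSpace G]
  [MeasurableSingletonClass G] [Group H] [TopologicalSpace H] [MeasurableSpace H]
  [MeasurableSingletonClass H] {U K : Set (G × H)}

/-- The integral `∫ ∑_{x ∈ D} ρ(π_G x) ⟨δ_x, φ(A_D) δ_x⟩ dμ(D)`. -/
def pasturShubin (ϑ : H → ℝ) (A : ∀ D : DeloneSpace U K, WeightedL2 ϑ D →L[ℂ] WeightedL2 ϑ D)
    (μ : Measure (DeloneSpace U K)) (ρ : G → ℝ) (φ : ℝ → ℝ) : ℂ :=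
  ∫ D, ∑' x : D.carrier,
    (ρ x.1.1 : ℂ) * inner ℂ (delta ϑ D x.1) (functionalCalculus φ (A D) (delta ϑ D x.1)) ∂μ

/-- The Radon measure `η` on `ℝ` is the `ϑ`-weighted density of states of the self-adjoint family
`A` with respect to `μ`, where `m` is the Haar measure of `G`: for every non-negative
`ρ ∈ C_c(G)` with `∫ ρ dm = 1`, the functional `φ ↦ η(φ)` on `C_c(ℝ)` is given by the
Pastur–Shubin formula. -/
structure IsDensityOfStates (m : Measure G) (ϑ : H → ℝ)
    (A : ∀ D : DeloneSpace U K, WeightedL2 ϑ D →L[ℂ] WeightedL2 ϑ D)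
    (μ : Measure (DeloneSpace U K)) (η : Measure ℝ) : Prop where
  isRadon : IsLocallyFiniteMeasure η
  formula : ∀ ρ : G → ℝ, Continuous ρ → HasCompactSupport ρ → (∀ g, 0 ≤ ρ g) →
    ∫ g, ρ g ∂m = 1 → ∀ φ : ℝ → ℝ, Continuous φ → HasCompactSupport φ →
      ((∫ t, φ t ∂η : ℝ) : ℂ) = pasturShubin ϑ A μ ρ φ

end DOS

end DeloneDOS

end

open DeloneDOS

set_option linter.unusedSectionVars false
set_option linter.unusedVariables false

noncomputable section

namespace DeloneDOS

open scoped CompactlySupported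

/-! ### The Fell topology -/

section Fell

variable {Z : Type*} [TopologicalSpace Z]

/-! Fix `ρ` with integral one. The density of states at `φ` is then the integral of a single
observable, `D ↦ ∑ x ∈ D, ρ(π_G x) ⟨δ_x, φ(A_D) δ_x⟩`, which does not involve the measure. The
theorem thus splits into two facts: the observable is continuous on the compact Hausdorff space of
all Delone sets, and `μl` converges weakly to `μ`.

Continuity (`continuous_diagonalSum`): kernels of finite type are closed under composition
(`IsKernelOf.mul`), because finite range makes the composition a finite sum over nearby points, and
such sums depend continuously on `D` (`DeloneSpace.continuousAt_tsum`). The Schur test bounds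
`‖A_D‖` by some `R` for all `D`, so one polynomial approximates `φ` on all the spectra at once.
Hence the diagonal coefficients of `φ(A)` are uniform limits of continuous ones.

Weak convergence (`IsUniquelyErgodicWith.tendsto_integral`): by compactness the `μl` have limits
along ultrafilters. Invariance passes to such a limit, and Fell convergence of `Ωl` forces it to
live on `Ω`, so by unique ergodicity it is `μ`.

Existence and independence of `ρ` (`existsUnique_isDensityOfStates`): for `φ ≥ 0`, invariance of the
measure makes the formula a positive left-invariant functional of `ρ`, hence a multiple of the Haar
integral. As a functional of `φ` it is positive, so the Riesz theorem supplies the measure on `ℝ`.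
-/

theorem FellSpace.isOpen_miss {C : Set Z} (hC : IsCompact C) :
    IsOpen {F : FellSpace Z | F.1 ∩ C = ∅} :=
  TopologicalSpace.isOpen_generateFrom_of_mem (Or.inl ⟨C, hC, rfl⟩)

theorem FellSpace.isOpen_hit {O : Set Z} (hO : IsOpen O) :
    IsOpen {F : FellSpace Z | (F.1 ∩ O).Nonempty} :=
  TopologicalSpace.isOpen_generateFrom_of_mem (Or.inr ⟨O, hO, rfl⟩)

theorem FellSpace.tendsto_nhds_iff {β : Type*} {f : β → FellSpace Z} {l : Filter β}
    {F : FellSpace Z} :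
    Tendsto f l (𝓝 F) ↔ (∀ C, IsCompact C → F.1 ∩ C = ∅ → ∀ᶠ b in l, (f b).1 ∩ C = ∅) ∧
      ∀ O, IsOpen O → (F.1 ∩ O).Nonempty → ∀ᶠ b in l, ((f b).1 ∩ O).Nonempty := by
  refine TopologicalSpace.tendsto_nhds_generateFrom_iff.trans ⟨fun h => ⟨?_, ?_⟩, ?_⟩
  · exact fun C hC hF => h _ (Or.inl ⟨C, hC, rfl⟩) hF
  · exact fun O hO hF => h _ (Or.inr ⟨O, hO, rfl⟩) hF
  · rintro ⟨h1, h2⟩ s (⟨C, hC, rfl⟩ | ⟨O, hO, rfl⟩) hF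
    · exact h1 C hC hF
    · exact h2 O hO hF

/-- An ultrafilter of closed sets converges to the set of points all of whose neighbourhoods are hit
by almost every member. Each point of a compact set off this limit has a neighbourhood missed by
almost every member, and finitely many of these cover the compact set. No local compactness is
needed. -/
instance FellSpace.compactSpace : CompactSpace (FellSpace Z) := by
  refine ⟨isCompact_iff_ultrafilter_le_nhds.2 fun 𝒰 _ => ?_⟩
  have hcl : IsClosed {x : Z | ∀ O, IsOpen O → x ∈ O →
      ∀ᶠ F : FellSpace Z in 𝒰, (F.1 ∩ O).Nonempty} := by
    rw [← isOpen_compl_iff, isOpen_iff_forall_mem_open]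
    intro x hx
    simp only [mem_compl_iff, mem_ofPred_eq, not_forall] at hx
    obtain ⟨O, hO, hxO, h⟩ := hx
    refine ⟨O, fun y hy h' => h (h' O hO hy), hO, hxO⟩
  refine ⟨⟨_, hcl⟩, mem_univ _, ?_⟩
  have : Tendsto (id : FellSpace Z → FellSpace Z) 𝒰 (𝓝 ⟨_, hcl⟩) := by
    refine FellSpace.tendsto_nhds_iff.2 ⟨fun C hC hF => ?_, fun O hO ⟨x, hx, hxO⟩ => hx O hO hxO⟩
    have hloc : ∀ x ∈ C, ∃ O, IsOpen O ∧ x ∈ O ∧ ∀ᶠ F : FellSpace Z in 𝒰, F.1 ∩ O = ∅ := by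
      intro x hx
      have hx' : x ∉ {x : Z | ∀ O, IsOpen O → x ∈ O →
          ∀ᶠ F : FellSpace Z in 𝒰, (F.1 ∩ O).Nonempty} := fun h =>
        (eq_empty_iff_forall_notMem.1 hF x) ⟨h, hx⟩
      simp only [mem_ofPred_eq, not_forall] at hx'
      obtain ⟨O, hO, hxO, h⟩ := hx'
      refine ⟨O, hO, hxO, ?_⟩
      filter_upwards [Ultrafilter.eventually_not.2 h] with F hF
      exact not_nonempty_iff_eq_empty.1 hF
    choose! O hO hxO hev using hloc
    obtain ⟨t, htC, ht⟩ := hC.elim_nhds_subcover O fun x hx => (hO x hx).mem_nhds (hxO x hx)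
    have := (Filter.eventually_all_finset t).2 fun x hx => hev x (htC x hx)
    filter_upwards [this] with F hF'
    refine eq_empty_iff_forall_notMem.2 fun y hy => ?_
    obtain ⟨x, hx, hyx⟩ := mem_iUnion₂.1 (ht hy.2)
    exact (eq_empty_iff_forall_notMem.1 (hF' x hx) y) ⟨hy.1, hyx⟩
  exact this

/-- A compact neighbourhood `C` of `x` off `F'` separates: hitting the interior of `C` excludes
missing `C`. -/
theorem FellSpace.exists_disjoint_nhds [LocallyCompactSpace Z] {F F' : FellSpace Z} {x : Z}
    (hx : x ∈ F.1) (hx' : x ∉ F'.1) :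
    ∃ u v : Set (FellSpace Z), IsOpen u ∧ IsOpen v ∧ F ∈ u ∧ F' ∈ v ∧ Disjoint u v := by
  obtain ⟨C, hC, hxC, hCF⟩ := exists_compact_subset F'.2.isOpen_compl hx'
  refine ⟨_, _, FellSpace.isOpen_hit isOpen_interior, FellSpace.isOpen_miss hC, ⟨x, hx, hxC⟩, ?_,
    ?_⟩
  · exact eq_empty_iff_forall_notMem.2 fun y hy => hCF hy.2 hy.1
  · refine Set.disjoint_left.2 fun E ⟨y, hy, hyC⟩ hE => ?_
    exact (eq_empty_iff_forall_notMem.1 hE y) ⟨hy, interior_subset hyC⟩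

instance FellSpace.t2Space [LocallyCompactSpace Z] : T2Space (FellSpace Z) := by
  refine ⟨fun F F' hne => ?_⟩
  by_cases h : ∃ x, x ∈ F.1 ∧ x ∉ F'.1
  · obtain ⟨x, hx, hx'⟩ := h
    exact FellSpace.exists_disjoint_nhds hx hx'
  · push Not at h
    have h' : ∃ x, x ∈ F'.1 ∧ x ∉ F.1 := by
      by_contra hc
      push Not at hc
      exact hne (Subtype.ext (Subset.antisymm h hc))
    obtain ⟨x, hx, hx'⟩ := h'
    obtain ⟨u, v, hu, hv, h1, h2, hd⟩ := FellSpace.exists_disjoint_nhds hx hx'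
    exact ⟨v, u, hv, hu, h2, h1, hd.symm⟩

end Fell

/-! ### The space of Delone sets -/

section DeloneSpace

variable {X : Type*} [Group X] [TopologicalSpace X] {U K : Set X}

theorem DeloneSpace.isOpen_miss {C : Set X} (hC : IsCompact C) :
    IsOpen {D : DeloneSpace U K | D.carrier ∩ C = ∅} :=
  (FellSpace.isOpen_miss hC).preimage continuous_subtype_val

theorem DeloneSpace.isOpen_hit {O : Set X} (hO : IsOpen O) :
    IsOpen {D : DeloneSpace U K | (D.carrier ∩ O).Nonempty} :=
  (FellSpace.isOpen_hit hO).preimage continuous_subtype_val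

instance DeloneSpace.t2Space [LocallyCompactSpace X] : T2Space (DeloneSpace U K) :=
  inferInstanceAs (T2Space {D : FellSpace X // IsDelone U K D.1})

/-- Both defining conditions are closed in the Fell topology. Relative density says that no compact
set `x • K⁻¹` is missed, and it implies non-emptiness. A failure of uniform discreteness is
witnessed by two disjoint open subsets of some `g • U`, both hit, which is an open condition. -/
theorem IsDelone.isClosed_setOf [IsTopologicalGroup X] [T2Space X] (hU : IsOpen U)
    (hK : IsCompact K) : IsClosed {D : FellSpace X | IsDelone U K D.1} := by
  have h : {D : FellSpace X | IsDelone U K D.1} =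
      {D | ∀ g : X, ((g • U) ∩ D.1).Subsingleton} ∩ {D | ∀ x : X, ¬ D.1 ∩ (x • K⁻¹) = ∅} := by
    ext D
    refine ⟨fun h => ⟨h.unifDiscrete, fun x hx => ?_⟩, fun h => ?_⟩
    · have hx' : x ∈ D.1 * K := h.relDense ▸ mem_univ x
      obtain ⟨d, hd, k, hk, rfl⟩ := hx'
      refine (eq_empty_iff_forall_notMem.1 hx d) ⟨hd, ?_⟩
      exact ⟨k⁻¹, by simpa using hk, by simp⟩
    · have hrel : D.1 * K = univ := by
        refine eq_univ_of_forall fun x => ?_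
        obtain ⟨d, hd, k, hk, hkd⟩ := nonempty_iff_ne_empty.2 (h.2 x)
        refine ⟨d, hd, k⁻¹, hk, ?_⟩
        simp only [smul_eq_mul] at hkd
        simp [← hkd]
      refine ⟨?_, h.1, hrel⟩
      obtain ⟨d, hd, -⟩ : (1 : X) ∈ D.1 * K := hrel ▸ mem_univ _
      exact ⟨d, hd⟩
  rw [h]
  refine IsClosed.inter ?_ ?_
  · rw [ofPred_forall]
    refine isClosed_iInter fun g => ?_
    rw [← isOpen_compl_iff, isOpen_iff_forall_mem_open]
    intro D hD
    simp only [mem_compl_iff, mem_ofPred_eq, Set.not_subsingleton_iff] at hD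
    obtain ⟨x, hx, y, hy, hxy⟩ := hD
    obtain ⟨V, W, hV, hW, hxV, hyW, hVW⟩ := t2_separation hxy
    refine ⟨_, ?_, (FellSpace.isOpen_hit (hV.inter (hU.smul g))).inter
      (FellSpace.isOpen_hit (hW.inter (hU.smul g))), ⟨x, hx.2, hxV, hx.1⟩, ⟨y, hy.2, hyW, hy.1⟩⟩
    rintro E ⟨⟨x', hx', hx'V, hx'U⟩, ⟨y', hy', hy'W, hy'U⟩⟩ hs
    have := hs ⟨hx'U, hx'⟩ ⟨hy'U, hy'⟩
    exact Set.disjoint_left.1 hVW hx'V (this ▸ hy'W)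
  · rw [ofPred_forall]
    refine isClosed_iInter fun x => ?_
    rw [← isOpen_compl_iff]
    convert! FellSpace.isOpen_miss (hK.inv.smul x) using 1
    ext D
    simp

theorem DeloneSpace.compactSpace [IsTopologicalGroup X] [T2Space X] (hU : IsOpen U)
    (hK : IsCompact K) : CompactSpace (DeloneSpace U K) :=
  isCompact_iff_compactSpace.1 (IsDelone.isClosed_setOf hU hK).isCompact

theorem DeloneSpace.continuous_translate [IsTopologicalGroup X] (g : X) :
    Continuous (DeloneSpace.translate g : DeloneSpace U K → DeloneSpace U K) := by
  refine Continuous.subtype_mk ?_ _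
  refine continuous_generateFrom_iff.2 ?_
  rintro s (⟨C, hC, rfl⟩ | ⟨O, hO, rfl⟩)
  · convert! DeloneSpace.isOpen_miss (U := U) (K := K) (hC.smul g⁻¹) using 1
    ext D
    have : (g • D.carrier) ∩ C = g • (D.carrier ∩ g⁻¹ • C) := by
      rw [Set.smul_set_inter, smul_inv_smul]
    change (g • D.carrier) ∩ C = ∅ ↔ D.carrier ∩ g⁻¹ • C = ∅
    rw [this, Set.smul_set_eq_empty]
  · convert! DeloneSpace.isOpen_hit (U := U) (K := K) (hO.smul g⁻¹) using 1
    ext D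
    have : (g • D.carrier) ∩ O = g • (D.carrier ∩ g⁻¹ • O) := by
      rw [Set.smul_set_inter, smul_inv_smul]
    change ((g • D.carrier) ∩ O).Nonempty ↔ (D.carrier ∩ g⁻¹ • O).Nonempty
    rw [this, Set.smul_set_nonempty]

theorem DeloneSpace.mul_mem_translate [IsTopologicalGroup X] {g x : X} {D : DeloneSpace U K} :
    g * x ∈ (D.translate g).carrier ↔ x ∈ D.carrier :=
  Set.smul_mem_smul_set_iff (a := g) (s := D.carrier)

/-- The number of points of a Delone set in a translate of a compact set is bounded. -/
theorem DeloneSpace.exists_encard_le [IsTopologicalGroup X] (hU : IsOpen U)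
    (hU1 : (1 : X) ∈ U) {C : Set X} (hC : IsCompact C) :
    ∃ N : ℕ, ∀ (D : DeloneSpace U K) (g : X), (D.carrier ∩ g • C).encard ≤ N := by
  -- The translates of `U` covering `C` are chosen once; left translation by `g` keeps their number,
  -- and each contains at most one point of any `D`.
  obtain ⟨t, -, ht⟩ := hC.elim_nhds_subcover (fun x => x • U) fun x _ =>
    (hU.smul x).mem_nhds ⟨1, hU1, by simp⟩
  refine ⟨t.card, fun D g => ?_⟩
  have hsub : D.carrier ∩ g • C ⊆ ⋃ x ∈ t, ((g * x) • U) ∩ D.carrier := by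
    rintro _ ⟨hy, c, hc, rfl⟩
    obtain ⟨x, hx, hcx⟩ := mem_iUnion₂.1 (ht hc)
    refine mem_iUnion₂.2 ⟨x, hx, ?_, hy⟩
    rw [mul_smul]
    exact Set.smul_mem_smul_set hcx
  refine (encard_le_encard hsub).trans ((t.set_encard_biUnion_le _).trans ?_)
  calc ∑ x ∈ t, (((g * x) • U) ∩ D.carrier).encard ≤ ∑ x ∈ t, 1 :=
        Finset.sum_le_sum fun x _ => encard_le_one_iff_subsingleton.2 (D.2.unifDiscrete _)
    _ = t.card := by simp

theorem DeloneSpace.finite_inter [IsTopologicalGroup X] (hU : IsOpen U)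
    (hU1 : (1 : X) ∈ U) {C : Set X} (hC : IsCompact C) (D : DeloneSpace U K) :
    (D.carrier ∩ C).Finite := by
  obtain ⟨N, hN⟩ := DeloneSpace.exists_encard_le (K := K) hU hU1 hC
  have := hN D 1
  rw [one_smul] at this
  exact finite_of_encard_le_coe this

end DeloneSpace

/-! ### Sums over a Delone set as functions of the Delone set. -/

section LocalSums

variable {X : Type*} [Group X] [TopologicalSpace X] [IsTopologicalGroup X] [T2Space X]
  {U K : Set X} {E : Type*} [NormedAddCommGroup E]

/-- Sums of continuous functions of compact support over the points of a Delone set depend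
continuously on the Delone set. -/
theorem DeloneSpace.continuousAt_tsum (hU : IsOpen U) (hU1 : (1 : X) ∈ U)
    {Y : Type*} [TopologicalSpace Y] {𝒟 : Y → DeloneSpace U K} {p₀ : Y} (h𝒟 : ContinuousAt 𝒟 p₀)
    {f : Y → X → E} {C : Set X} (hC : IsCompact C)
    (hsupp : ∀ᶠ p in 𝓝 p₀, ∀ z ∈ (𝒟 p).carrier, z ∉ C → f p z = 0)
    (hf : ∀ z₀ ∈ (𝒟 p₀).carrier, Tendsto (fun q : Y × X => f q.1 q.2)
      (𝓝[{q | q.2 ∈ (𝒟 q.1).carrier}] (p₀, z₀)) (𝓝 (f p₀ z₀))) :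
    ContinuousAt (fun p => ∑' z : (𝒟 p).carrier, f p z) p₀ := by
  classical
  have hfin := DeloneSpace.finite_inter hU hU1 hC (𝒟 p₀)
  set s : Finset X := hfin.toFinset with hs
  have hmem : ∀ z, z ∈ s ↔ z ∈ (𝒟 p₀).carrier ∧ z ∈ C := fun z => by simp [hs]
  rw [Metric.continuousAt_iff']
  intro ε hε
  obtain ⟨δ, hδ, hδε⟩ : ∃ δ > 0, (s.card : ℝ) * δ < ε := by
    refine ⟨ε / (s.card + 1), by positivity, ?_⟩
    rw [mul_div_assoc', div_lt_iff₀ (by positivity)]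
    nlinarith
  obtain ⟨W, hW, hWd⟩ := hfin.t2_separation
  -- Each `V z` lies in `z • U`, so it holds at most one point of any Delone set, and in `W z`, so
  -- different `V z` are disjoint.
  have hloc : ∀ z ∈ s, ∃ V : Set X, IsOpen V ∧ z ∈ V ∧ V ⊆ W z ∩ z • U ∧
      ∀ᶠ p in 𝓝 p₀, ∀ w ∈ V, w ∈ (𝒟 p).carrier → dist (f p w) (f p₀ z) < δ := by
    intro z hz
    have h1 := Metric.tendsto_nhds.1 (hf z ((hmem z).1 hz).1) δ hδ
    rw [eventually_nhdsWithin_iff, nhds_prod_eq, eventually_prod_iff] at h1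
    obtain ⟨P, hP, Q, hQ, h⟩ := h1
    have hz' : W z ∩ z • U ∈ 𝓝 z :=
      ((hW z).2.inter (hU.smul z)).mem_nhds ⟨(hW z).1, 1, hU1, by simp⟩
    obtain ⟨V, hVs, hV, hzV⟩ := mem_nhds_iff.1 (inter_mem hz' hQ)
    refine ⟨V, hV, hzV, fun w hw => (hVs hw).1, ?_⟩
    filter_upwards [hP] with p hp w hw hwp
    exact h hp (hVs hw).2 hwp
  choose! V hV hzV hVW hVf using hloc
  -- For `p` near `p₀` every `V z` is hit and the rest of `C` is missed. The points of `𝒟 p` that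
  -- can contribute thus correspond to `s`, one point `w z` in each `V z`.
  have hhit : ∀ᶠ p in 𝓝 p₀, ∀ z ∈ s, ((𝒟 p).carrier ∩ V z).Nonempty := by
    refine (eventually_all_finset s).2 fun z hz => ?_
    exact h𝒟.eventually ((DeloneSpace.isOpen_hit (hV z hz)).mem_nhds
      ⟨z, ((hmem z).1 hz).1, hzV z hz⟩)
  have hmiss : ∀ᶠ p in 𝓝 p₀, (𝒟 p).carrier ∩ (C \ ⋃ z ∈ s, V z) = ∅ := by
    refine h𝒟.eventually ((DeloneSpace.isOpen_miss
      (hC.diff (isOpen_biUnion fun z hz => hV z hz))).mem_nhds ?_)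
    refine eq_empty_iff_forall_notMem.2 fun z hz => hz.2.2 ?_
    have hzs : z ∈ s := (hmem z).2 ⟨hz.1, hz.2.1⟩
    exact mem_iUnion₂.2 ⟨z, hzs, hzV z hzs⟩
  have hnear := (eventually_all_finset s).2 fun z hz => hVf z hz
  have hp₀ : ∑' z : (𝒟 p₀).carrier, f p₀ z = ∑ z ∈ s, f p₀ z := by
    rw [tsum_subtype (𝒟 p₀).carrier (f p₀), tsum_eq_sum (s := s)]
    · exact Finset.sum_congr rfl fun z hz => indicator_of_mem ((hmem z).1 hz).1 _
    · intro z hz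
      by_cases hzD : z ∈ (𝒟 p₀).carrier
      · rw [indicator_of_mem hzD]
        exact hsupp.self_of_nhds z hzD fun hzC => hz ((hmem z).2 ⟨hzD, hzC⟩)
      · exact indicator_of_notMem hzD _
  filter_upwards [hhit, hmiss, hnear, hsupp] with p h1 h2 h3 h4
  choose! w hw using h1
  have huniq : ∀ z ∈ s, ∀ y ∈ (𝒟 p).carrier, y ∈ V z → y = w z := fun z hz y hy hyV =>
    (𝒟 p).2.unifDiscrete z ⟨(hVW z hz hyV).2, hy⟩ ⟨(hVW z hz (hw z hz).2).2, (hw z hz).1⟩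
  have hinj : Set.InjOn w s := by
    intro z hz z' hz' hzz
    by_contra hne
    refine Set.disjoint_left.1 (hWd ?_ ?_ hne) (hVW z hz (hw z hz).2).1
      (hzz ▸ (hVW z' hz' (hw z' hz').2).1)
    · exact hfin.mem_toFinset.1 hz
    · exact hfin.mem_toFinset.1 hz'
  have hp : ∑' z : (𝒟 p).carrier, f p z = ∑ z ∈ s, f p (w z) := by
    rw [tsum_subtype (𝒟 p).carrier (f p), tsum_eq_sum (s := s.image w), Finset.sum_image hinj]
    · exact Finset.sum_congr rfl fun z hz => indicator_of_mem (hw z hz).1 _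
    · intro y hy
      by_cases hyD : y ∈ (𝒟 p).carrier
      · rw [indicator_of_mem hyD]
        refine h4 y hyD fun hyC => hy ?_
        by_contra hc
        refine (eq_empty_iff_forall_notMem.1 h2 y) ⟨hyD, hyC, fun hyV => ?_⟩
        obtain ⟨z, hz, hyz⟩ := mem_iUnion₂.1 hyV
        exact hy (Finset.mem_image.2 ⟨z, hz, (huniq z hz y hyD hyz).symm⟩)
      · exact indicator_of_notMem hyD _
  rw [hp, hp₀]
  calc dist (∑ z ∈ s, f p (w z)) (∑ z ∈ s, f p₀ z)
      ≤ ∑ z ∈ s, dist (f p (w z)) (f p₀ z) := dist_sum_sum_le _ _ _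
    _ ≤ ∑ _z ∈ s, δ := Finset.sum_le_sum fun z hz => (h3 z hz (w z) (hw z hz).2 (hw z hz).1).le
    _ = s.card * δ := by simp
    _ < ε := hδε

theorem DeloneSpace.tsum_translate (g : X) (D : DeloneSpace U K) (f : X → E) :
    ∑' z : (D.translate g).carrier, f z = ∑' z : D.carrier, f (g * z) := by
  rw [tsum_subtype _ f, tsum_subtype _ (fun z => f (g * z)), ← (Equiv.mulLeft g).tsum_eq]
  refine tsum_congr fun z => ?_
  by_cases hz : z ∈ D.carrier
  · rw [indicator_of_mem hz, Equiv.coe_mulLeft,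
      indicator_of_mem (DeloneSpace.mul_mem_translate.2 hz)]
  · rw [indicator_of_notMem hz, Equiv.coe_mulLeft,
      indicator_of_notMem fun h => hz (DeloneSpace.mul_mem_translate.1 h)]

end LocalSums

/-- A product of a bounded function that is continuous on `T ∩ {w ≠ 0}` with the continuous
function `w` is continuous on `T`. -/
theorem _root_.ContinuousOn.mul_of_bounded {Y : Type*} [TopologicalSpace Y] {T : Set Y}
    {a w : Y → ℂ} {C : ℝ} (ha : ContinuousOn a (T ∩ {y | w y ≠ 0}))
    (hb : ∀ y ∈ T ∩ {y | w y ≠ 0}, ‖a y‖ ≤ C) (hw : Continuous w) :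
    ContinuousOn (fun y => a y * w y) T := by
  intro y hy
  by_cases h : w y = 0
  · rw [ContinuousWithinAt, h, mul_zero]
    have h0 : Tendsto (fun y' => C * ‖w y'‖) (𝓝[T] y) (𝓝 0) := by
      have : Tendsto (fun y' => C * ‖w y'‖) (𝓝 y) (𝓝 (C * ‖w y‖)) :=
        (continuous_const.mul hw.norm).tendsto y
      rw [h, norm_zero, mul_zero] at this
      exact this.mono_left nhdsWithin_le_nhds
    refine squeeze_zero_norm' ?_ h0
    filter_upwards [self_mem_nhdsWithin] with y' hy'
    by_cases h' : w y' = 0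
    · simp [h']
    · rw [norm_mul]
      exact mul_le_mul_of_nonneg_right (hb y' ⟨hy', h'⟩) (norm_nonneg _)
  · have ho : {y | w y ≠ 0} ∈ 𝓝 y := (isOpen_ne.preimage hw).mem_nhds h
    refine ContinuousWithinAt.mul ?_ hw.continuousWithinAt
    exact (ha y ⟨hy, h⟩).mono_of_mem_nhdsWithin (inter_mem_nhdsWithin T ho)

theorem DeloneSpace.countable_carrier {X : Type*} [Group X] [TopologicalSpace X]
    [IsTopologicalGroup X] [SigmaCompactSpace X] {U K : Set X} (hU : IsOpen U)
    (hU1 : (1 : X) ∈ U) (D : DeloneSpace U K) : D.carrier.Countable := by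
  have h : D.carrier = ⋃ n, D.carrier ∩ compactCovering X n := by
    rw [← inter_iUnion, iUnion_compactCovering, inter_univ]
  rw [h]
  exact countable_iUnion fun n =>
    (DeloneSpace.finite_inter hU hU1 (isCompact_compactCovering X n) D).countable

/-! ### Point masses and coordinates in `ℓ²(D, ϑ)`. -/

section WeightedL2

variable {G H : Type*} [Group G] [TopologicalSpace G] [MeasurableSpace G]
  [MeasurableSingletonClass G] [Group H] [TopologicalSpace H] [MeasurableSpace H]
  [MeasurableSingletonClass H] {U K : Set (G × H)} {ϑ : H → ℝ} {D : DeloneSpace U K}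

theorem lintegral_weightedCount (f : G × H → ℝ≥0∞) :
    ∫⁻ x, f x ∂(weightedCount ϑ D) = ∑' x : D.carrier, ENNReal.ofReal (ϑ x.1.2) * f x := by
  simp [weightedCount, lintegral_sum_measure, lintegral_smul_measure, lintegral_dirac]

theorem ae_weightedCount_iff (hD : D.carrier.Countable) {P : G × H → Prop} :
    (∀ᵐ x ∂(weightedCount ϑ D), P x) ↔ ∀ x ∈ D.carrier, 0 < ϑ x.2 → P x := by
  have := hD.to_subtype
  rw [weightedCount, Measure.ae_sum_iff]
  refine ⟨fun h x hx hϑx => ?_, fun h x => ?_⟩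
  · have := h ⟨x, hx⟩
    rw [Measure.ae_ennreal_smul_measure_iff (by simpa using hϑx), ae_dirac_eq] at this
    exact this
  · by_cases hϑx : 0 < ϑ x.1.2
    · rw [Measure.ae_ennreal_smul_measure_iff (by simpa using hϑx), ae_dirac_eq]
      exact h x.1 x.2 hϑx
    · simp [ENNReal.ofReal_of_nonpos (not_lt.1 hϑx)]

theorem measureReal_weightedCount_singleton (hϑ0 : ∀ h, 0 ≤ ϑ h) {x : G × H}
    (hx : x ∈ D.carrier) : (weightedCount ϑ D).real {x} = ϑ x.2 := by
  rw [measureReal_def, weightedCount, Measure.sum_apply _ (measurableSet_singleton x),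
    tsum_eq_single (⟨x, hx⟩ : D.carrier)]
  · simp [ENNReal.toReal_ofReal (hϑ0 _)]
  · intro y hy
    have hne : y.1 ≠ x := fun h => hy (Subtype.ext h)
    simp [hne]

theorem inner_delta (hϑ0 : ∀ h, 0 ≤ ϑ h) {x : G × H} (hx : x ∈ D.carrier)
    (u : WeightedL2 ϑ D) : inner ℂ (delta ϑ D x) u = ϑ x.2 * u x := by
  rw [delta, L2.inner_indicatorConstLp_one, integral_singleton,
    measureReal_weightedCount_singleton hϑ0 hx]
  simp

theorem inner_delta_delta (hϑ0 : ∀ h, 0 ≤ ϑ h) [DecidableEq (G × H)] {x y : G × H}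
    (hx : x ∈ D.carrier) :
    inner ℂ (delta ϑ D x) (delta ϑ D y) = if x = y then (ϑ x.2 : ℂ) else 0 := by
  rw [delta, L2.inner_indicatorConstLp_one, delta, setIntegral_indicatorConstLp
    (measurableSet_singleton x)]
  split_ifs with h
  · subst h
    rw [inter_self, measureReal_weightedCount_singleton hϑ0 hx]
    simp
  · have : ({y} : Set (G × H)) ∩ {x} = ∅ := by simpa using h
    simp [this]

theorem norm_delta_sq (hϑ0 : ∀ h, 0 ≤ ϑ h) {x : G × H} (hx : x ∈ D.carrier) :
    ‖delta ϑ D x‖ ^ 2 = ϑ x.2 := by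
  classical
  rw [← inner_self_eq_norm_sq (𝕜 := ℂ), inner_delta_delta hϑ0 hx, if_pos rfl]
  simp

theorem delta_eq_zero (hϑ0 : ∀ h, 0 ≤ ϑ h) {x : G × H} (hx : x ∈ D.carrier) (h : ϑ x.2 = 0) :
    delta ϑ D x = 0 := by
  have := norm_delta_sq hϑ0 hx
  rw [h] at this
  simpa using this

theorem WeightedL2.ext_inner_delta (hϑ0 : ∀ h, 0 ≤ ϑ h) (hD : D.carrier.Countable)
    {u v : WeightedL2 ϑ D}
    (h : ∀ x ∈ D.carrier, inner ℂ (delta ϑ D x) u = inner ℂ (delta ϑ D x) v) : u = v := by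
  refine Lp.ext ((ae_weightedCount_iff hD).2 fun x hx hϑx => ?_)
  have := h x hx
  rw [inner_delta hϑ0 hx, inner_delta hϑ0 hx] at this
  exact mul_left_cancel₀ (by exact_mod_cast hϑx.ne') this

/-- Applied to `T δ_y` for a kernel of finite range, this turns composition of operators into finite
algebra, with no question of convergence. -/
theorem WeightedL2.eq_sum_delta (hϑ0 : ∀ h, 0 ≤ ϑ h) (hD : D.carrier.Countable)
    {u : WeightedL2 ϑ D} {s : Finset (G × H)} {c : G × H → ℂ}
    (h : ∀ x ∈ D.carrier, inner ℂ (delta ϑ D x) u = ϑ x.2 * c x)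
    (hs : ∀ x ∈ D.carrier, x ∉ s → ϑ x.2 * c x = 0) :
    u = ∑ z ∈ s, c z • delta ϑ D z := by
  classical
  refine WeightedL2.ext_inner_delta hϑ0 hD fun x hx => ?_
  rw [h x hx, inner_sum]
  simp only [inner_smul_right, inner_delta_delta hϑ0 hx, mul_ite, mul_zero]
  rw [Finset.sum_ite_eq]
  split_ifs with hxs
  · ring
  · exact hs x hx hxs

end WeightedL2

/-! ### Kernels of finite range and their composition. -/

section Kernels

variable {G H : Type*} [Group G] [TopologicalSpace G] [IsTopologicalGroup G]
  [MeasurableSpace G] [MeasurableSingletonClass G] [Group H] [TopologicalSpace H]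
  [IsTopologicalGroup H] [MeasurableSpace H] [MeasurableSingletonClass H] {U K : Set (G × H)}

/-- The triples `(x, D, y)` with `x, y ∈ D` of non-zero weight. -/
def weightDomain (U K : Set (G × H)) (ϑ : H → ℝ) :
    Set ((G × H) × DeloneSpace U K × (G × H)) :=
  {p | p.1 ∈ p.2.1.carrier ∧ p.2.2 ∈ p.2.1.carrier ∧ ϑ p.1.2 ≠ 0 ∧ ϑ p.2.2.2 ≠ 0}

/-- Restricting to non-zero weights loses nothing: `δ_x` vanishes where `ϑ` does, and the factors
`ϑ` in the matrix coefficients restore continuity there. -/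
theorem weightDomain_subset {ϑ : H → ℝ} : weightDomain U K ϑ ⊆ kernelDomain U K ϑ :=
  fun _ h => ⟨h.1, h.2.1, subset_tsupport _ h.2.2.1, subset_tsupport _ h.2.2.2⟩

/-- The function `a` is bounded, continuous, invariant and of finite range at the points of
non-zero weight, and the matrix coefficients of the family `T` are given by `a`. -/
structure IsKernelOf (ϑ : H → ℝ) (a : (G × H) × DeloneSpace U K × (G × H) → ℂ)
    (T : ∀ D : DeloneSpace U K, WeightedL2 ϑ D →L[ℂ] WeightedL2 ϑ D) : Prop where
  continuousOn : ContinuousOn a (weightDomain U K ϑ)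
  bounded : ∃ C : ℝ, ∀ p ∈ weightDomain U K ϑ, ‖a p‖ ≤ C
  finiteRange : ∃ Ka : Set G, IsCompact Ka ∧
    ∀ p ∈ weightDomain U K ϑ, (p.1⁻¹ * p.2.2).1 ∉ Ka → a p = 0
  invariant : ∀ g : G, ∀ x D y, (x, D, y) ∈ weightDomain U K ϑ →
    a ((g, (1 : H)) * x, D.translate (g, (1 : H)), (g, (1 : H)) * y) = a (x, D, y)
  inner_delta : ∀ D : DeloneSpace U K, ∀ x ∈ D.carrier, ∀ y ∈ D.carrier,
    inner ℂ (delta ϑ D x) (T D (delta ϑ D y)) = ϑ x.2 * (a (x, D, y) * ϑ y.2)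

variable {ϑ : H → ℝ}

theorem HasKernel.apply_delta (hϑ0 : ∀ h, 0 ≤ ϑ h) {D : DeloneSpace U K}
    (hD : D.carrier.Countable) {a : (G × H) × DeloneSpace U K × (G × H) → ℂ}
    {T : WeightedL2 ϑ D →L[ℂ] WeightedL2 ϑ D} (hT : HasKernel ϑ a D T) {x y : G × H}
    (hx : x ∈ D.carrier) (hϑx : 0 < ϑ x.2) (hy : y ∈ D.carrier) :
    T (delta ϑ D y) x = a (x, D, y) * ϑ y.2 := by
  have h1 := (ae_weightedCount_iff hD).1 (hT (delta ϑ D y)) x hx hϑx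
  refine h1.trans ?_
  have h2 : (fun z => a (x, D, z) * delta ϑ D y z) =ᵐ[weightedCount ϑ D]
      ({y} : Set (G × H)).indicator fun z => a (x, D, z) := by
    have h3 : (delta ϑ D y : G × H → ℂ) =ᵐ[weightedCount ϑ D] _ := indicatorConstLp_coeFn
    filter_upwards [h3] with z hz
    rw [hz]
    by_cases hzy : z = y <;> simp [hzy]
  refine (integral_congr_ae h2).trans ?_
  rw [integral_indicator (measurableSet_singleton y), integral_singleton,
    measureReal_weightedCount_singleton hϑ0 hy, mul_comm]
  simp

theorem IsFiniteTypeKernel.isKernelOf (hϑ0 : ∀ h, 0 ≤ ϑ h)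
    (hD : ∀ D : DeloneSpace U K, D.carrier.Countable)
    {a : (G × H) × DeloneSpace U K × (G × H) → ℂ} (ha : IsFiniteTypeKernel ϑ a)
    {T : ∀ D : DeloneSpace U K, WeightedL2 ϑ D →L[ℂ] WeightedL2 ϑ D}
    (hT : ∀ D, HasKernel ϑ a D (T D)) : IsKernelOf ϑ a T where
  continuousOn := ha.continuousOn.mono weightDomain_subset
  bounded := ha.bounded.imp fun C hC p hp => hC p (weightDomain_subset hp)
  finiteRange := by
    obtain ⟨Ka, hKa, -, h⟩ := ha.finiteRange
    exact ⟨Ka, hKa, fun p hp => h p (weightDomain_subset hp)⟩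
  invariant g x D y h := ha.invariant g x D y (weightDomain_subset h)
  inner_delta D x hx y hy := by
    rw [DeloneDOS.inner_delta hϑ0 hx]
    rcases (hϑ0 x.2).eq_or_lt with h | h
    · simp [← h]
    · rw [(hT D).apply_delta hϑ0 (hD D) hx h hy]

/-- The kernel of the composition of two families of operators. -/
def kernelMul (ϑ : H → ℝ) (b a : (G × H) × DeloneSpace U K × (G × H) → ℂ) :
    (G × H) × DeloneSpace U K × (G × H) → ℂ :=
  fun p => ∑' z : p.2.1.carrier, b (p.1, p.2.1, z) * a (z, p.2.1, p.2.2) * ϑ z.1.2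

variable {b a : (G × H) × DeloneSpace U K × (G × H) → ℂ}
  {S T : ∀ D : DeloneSpace U K, WeightedL2 ϑ D →L[ℂ] WeightedL2 ϑ D}

/-- Finite range of the right factor alone, together with the weight at `z`, confines `z` to a
translate of one fixed compact set. Translates of a fixed set contain a uniformly bounded number of
points of `D`. -/
theorem kernelMul_term_eq_zero {Ka : Set G}
    (hKa : ∀ p ∈ weightDomain U K ϑ, (p.1⁻¹ * p.2.2).1 ∉ Ka → a p = 0) {D : DeloneSpace U K}
    {x y z : G × H} (hy : y ∈ D.carrier) (hϑy : ϑ y.2 ≠ 0) (hz : z ∈ D.carrier)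
    (h : z ∉ ((y.1, (1 : H)) • (Ka⁻¹ ×ˢ tsupport ϑ) : Set (G × H))) :
    b (x, D, z) * a (z, D, y) * ϑ z.2 = 0 := by
  by_cases hϑz : ϑ z.2 = 0
  · simp [hϑz]
  · rw [hKa (z, D, y) ⟨hz, hy, hϑz, hϑy⟩, mul_zero, zero_mul]
    intro hmem
    refine h ⟨(y.1⁻¹ * z.1, z.2), ⟨?_, subset_tsupport _ hϑz⟩, ?_⟩
    · simpa using hmem
    · ext <;> simp

theorem exists_finset_kernelMul_eq_sum (hU : IsOpen U) (hU1 : (1 : G × H) ∈ U)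
    (hϑc : HasCompactSupport ϑ) {Ka : Set G} (hKac : IsCompact Ka)
    (hKa : ∀ p ∈ weightDomain U K ϑ, (p.1⁻¹ * p.2.2).1 ∉ Ka → a p = 0) {D : DeloneSpace U K}
    {y : G × H} (hy : y ∈ D.carrier) (hϑy : ϑ y.2 ≠ 0) :
    ∃ s : Finset (G × H), (s : Set (G × H)) =
      D.carrier ∩ ((y.1, (1 : H)) • (Ka⁻¹ ×ˢ tsupport ϑ) : Set (G × H)) ∧
      ∀ x, kernelMul ϑ b a (x, D, y) = ∑ z ∈ s, b (x, D, z) * a (z, D, y) * ϑ z.2 := by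
  have hC : IsCompact ((y.1, (1 : H)) • (Ka⁻¹ ×ˢ tsupport ϑ) : Set (G × H)) :=
    (hKac.inv.prod hϑc).smul _
  have hfin := DeloneSpace.finite_inter hU hU1 hC D
  refine ⟨hfin.toFinset, hfin.coe_toFinset, fun x => ?_⟩
  rw [kernelMul, tsum_subtype D.carrier fun z => b (x, D, z) * a (z, D, y) * ϑ z.2,
    tsum_eq_sum (s := hfin.toFinset)]
  · refine Finset.sum_congr rfl fun z hz => indicator_of_mem ?_ _
    exact (hfin.mem_toFinset.1 hz).1
  · intro z hz
    by_cases hzD : z ∈ D.carrier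
    · rw [indicator_of_mem hzD]
      exact kernelMul_term_eq_zero hKa hy hϑy hzD fun h => hz (hfin.mem_toFinset.2 ⟨hzD, h⟩)
    · exact indicator_of_notMem hzD _

theorem IsKernelOf.continuousOn_kernelMul [T2Space G] [T2Space H] [LocallyCompactSpace G]
    (hU : IsOpen U) (hU1 : (1 : G × H) ∈ U) (hϑ : Continuous ϑ)
    (hϑc : HasCompactSupport ϑ) (hb : IsKernelOf ϑ b S) (ha : IsKernelOf ϑ a T) :
    ContinuousOn (kernelMul ϑ b a) (weightDomain U K ϑ) := by
  obtain ⟨Ka, hKac, hKa⟩ := ha.finiteRange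
  obtain ⟨Ca, hCa⟩ := ha.bounded
  obtain ⟨Cb, hCb⟩ := hb.bounded
  rw [continuousOn_iff_continuous_domRestrict, continuous_iff_continuousAt]
  intro p₀
  -- The compact set containing the relevant `z` moves with `y`; letting `y` range over a compact
  -- neighbourhood gives one compact set for all nearby triples.
  obtain ⟨N, hN, hNp⟩ := exists_compact_mem_nhds p₀.1.2.2.1
  refine DeloneSpace.continuousAt_tsum hU hU1
    (𝒟 := fun p : weightDomain U K ϑ => p.1.2.1)
    (f := fun p z => b (p.1.1, p.1.2.1, z) * a (z, p.1.2.1, p.1.2.2) * ϑ z.2)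
    (by fun_prop) (C := (N * Ka⁻¹) ×ˢ tsupport ϑ) ((hN.mul hKac.inv).prod hϑc) ?_ ?_
  · have hc : ContinuousAt (fun p : weightDomain U K ϑ => p.1.2.2.1) p₀ := by fun_prop
    filter_upwards [hc hNp] with p hp z hz hzC
    refine kernelMul_term_eq_zero hKa p.2.2.1 p.2.2.2.2 hz ?_
    rintro ⟨k, hk, rfl⟩
    exact hzC ⟨Set.mul_mem_mul hp hk.1, by simpa using hk.2⟩
  · intro z hz
    -- The kernels are controlled only where `ϑ` is non-zero at `z`. Near other points boundedness
    -- and the factor `ϑ` force the term to zero.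
    have h := ContinuousOn.mul_of_bounded
      (T := {q : weightDomain U K ϑ × (G × H) | q.2 ∈ q.1.1.2.1.carrier})
      (a := fun q => b (q.1.1.1, q.1.1.2.1, q.2) * a (q.2, q.1.1.2.1, q.1.1.2.2))
      (w := fun q => (ϑ q.2.2 : ℂ)) (C := Cb * Ca) ?_ ?_ (by fun_prop)
    · exact h (p₀, z) hz
    · refine (hb.continuousOn.comp (by fun_prop) ?_).mul
        (ha.continuousOn.comp (by fun_prop) ?_)
      · exact fun q hq => ⟨q.1.2.1, hq.1, q.1.2.2.2.1, fun h => hq.2 (by simp [h])⟩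
      · exact fun q hq => ⟨hq.1, q.1.2.2.1, fun h => hq.2 (by simp [h]), q.1.2.2.2.2⟩
    · intro q hq
      have hq2 : ϑ q.2.2 ≠ 0 := fun h => hq.2 (by simp [h])
      have h1 := hCb (q.1.1.1, q.1.1.2.1, q.2) ⟨q.1.2.1, hq.1, q.1.2.2.2.1, hq2⟩
      have h2 := hCa (q.2, q.1.1.2.1, q.1.1.2.2) ⟨hq.1, q.1.2.2.1, hq2, q.1.2.2.2.2⟩
      rw [norm_mul]
      exact mul_le_mul h1 h2 (norm_nonneg _) ((norm_nonneg _).trans h1)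

theorem IsKernelOf.mul [T2Space G] [T2Space H] [LocallyCompactSpace G]
    (hU : IsOpen U) (hU1 : (1 : G × H) ∈ U)
    (hD : ∀ D : DeloneSpace U K, D.carrier.Countable) (hϑ : Continuous ϑ)
    (hϑc : HasCompactSupport ϑ) (hϑ0 : ∀ h, 0 ≤ ϑ h) (hb : IsKernelOf ϑ b S)
    (ha : IsKernelOf ϑ a T) : IsKernelOf ϑ (kernelMul ϑ b a) fun D => S D * T D where
  continuousOn := hb.continuousOn_kernelMul hU hU1 hϑ hϑc ha
  bounded := by
    obtain ⟨Ka, hKac, hKa⟩ := ha.finiteRange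
    obtain ⟨Ca, hCa⟩ := ha.bounded
    obtain ⟨Cb, hCb⟩ := hb.bounded
    obtain ⟨W, hW⟩ := hϑ.bounded_above_of_compact_support hϑc
    obtain ⟨N, hN⟩ := DeloneSpace.exists_encard_le (K := K) hU hU1 (hKac.inv.prod hϑc)
    refine ⟨N * (|Cb| * |Ca| * W), fun ⟨x, D, y⟩ ⟨hx, hy, hϑx, hϑy⟩ => ?_⟩
    obtain ⟨s, hs, hsum⟩ := exists_finset_kernelMul_eq_sum (b := b) hU hU1 hϑc hKac hKa hy hϑy
    have hcard : s.card ≤ N := by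
      have := hN D (y.1, (1 : H))
      rw [← hs, encard_coe_eq_coe_finsetCard] at this
      exact_mod_cast this
    have hW0 : 0 ≤ W := (norm_nonneg _).trans (hW 1)
    rw [hsum]
    calc ‖∑ z ∈ s, b (x, D, z) * a (z, D, y) * ϑ z.2‖
        ≤ ∑ z ∈ s, |Cb| * |Ca| * W := by
          refine norm_sum_le_of_le _ fun z hz => ?_
          have hzD : z ∈ D.carrier := by
            have : z ∈ (s : Set (G × H)) := hz
            rw [hs] at this
            exact this.1
          by_cases hϑz : ϑ z.2 = 0
          · simp only [hϑz, Complex.ofReal_zero, mul_zero, norm_zero]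
            positivity
          · rw [norm_mul, norm_mul, Complex.norm_real]
            have h1 := (hCb (x, D, z) ⟨hx, hzD, hϑx, hϑz⟩).trans (le_abs_self _)
            have h2 := (hCa (z, D, y) ⟨hzD, hy, hϑz, hϑy⟩).trans (le_abs_self _)
            have h3 := hW z.2
            gcongr
      _ = s.card * (|Cb| * |Ca| * W) := by simp
      _ ≤ N * (|Cb| * |Ca| * W) := by gcongr
  finiteRange := by
    obtain ⟨Ka, hKac, hKa⟩ := ha.finiteRange
    obtain ⟨Kb, hKbc, hKb⟩ := hb.finiteRange
    refine ⟨Kb * Ka, hKbc.mul hKac, fun ⟨x, D, y⟩ ⟨hx, hy, hϑx, hϑy⟩ h => ?_⟩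
    have h0 : ∀ z : D.carrier, b (x, D, z) * a (z, D, y) * ϑ z.1.2 = 0 := by
      intro z
      by_cases hϑz : ϑ z.1.2 = 0
      · simp [hϑz]
      · by_cases h1 : (x⁻¹ * z.1).1 ∈ Kb
        · rw [hKa (z, D, y) ⟨z.2, hy, hϑz, hϑy⟩, mul_zero, zero_mul]
          intro h2
          refine h ⟨_, h1, _, h2, ?_⟩
          simp [mul_assoc]
        · rw [hKb (x, D, z) ⟨hx, z.2, hϑx, hϑz⟩ h1, zero_mul, zero_mul]
    simp [kernelMul, h0]
  invariant g x D y := by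
    rintro ⟨hx, hy, hϑx, hϑy⟩
    change ∑' z : (D.translate (g, (1 : H))).carrier, b (_, _, z.1) * a (z.1, _, _) * ϑ z.1.2 = _
    rw [DeloneSpace.tsum_translate (g, (1 : H)) D fun z =>
      b ((g, (1 : H)) * x, D.translate (g, (1 : H)), z) *
        a (z, D.translate (g, (1 : H)), (g, (1 : H)) * y) * ϑ z.2]
    refine tsum_congr fun z => ?_
    by_cases hϑz : ϑ z.1.2 = 0
    · simp [hϑz]
    · rw [hb.invariant g x D z ⟨hx, z.2, hϑx, hϑz⟩, ha.invariant g z D y ⟨z.2, hy, hϑz, hϑy⟩]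
      simp
  inner_delta D x hx y hy := by
    by_cases hϑy : ϑ y.2 = 0
    · simp [delta_eq_zero hϑ0 hy hϑy, hϑy]
    obtain ⟨Ka, hKac, hKa⟩ := ha.finiteRange
    obtain ⟨s, hs, hsum⟩ := exists_finset_kernelMul_eq_sum (b := b) hU hU1 hϑc hKac hKa hy hϑy
    have hTy : T D (delta ϑ D y) = ∑ z ∈ s, (a (z, D, y) * ϑ y.2) • delta ϑ D z := by
      refine WeightedL2.eq_sum_delta hϑ0 (hD D) (fun z hz => ha.inner_delta D z hz y hy) ?_
      intro z hz hzs
      -- With the left kernel equal to `1` the vanishing lemma reads `a (z, D, y) * ϑ z.2 = 0`.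
      have := kernelMul_term_eq_zero (b := fun _ => 1) (x := x) hKa hy hϑy hz fun h => hzs <| by
        have : z ∈ (s : Set (G × H)) := hs ▸ ⟨hz, h⟩
        exact this
      linear_combination (ϑ y.2 : ℂ) * this
    rw [mul_apply_eq_comp, hTy, map_sum, inner_sum, hsum, Finset.sum_mul,
      Finset.mul_sum]
    refine Finset.sum_congr rfl fun z hz => ?_
    have hzD : z ∈ D.carrier := by
      have : z ∈ (s : Set (G × H)) := hz
      rw [hs] at this
      exact this.1
    rw [map_smul, inner_smul_right, hb.inner_delta D x hx z hzD]
    ring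

end Kernels

/-! ### The Schur test: a norm bound uniform in the Delone set. -/

section SchurTest

theorem lintegral_mul_sq_le {α : Type*} [MeasurableSpace α] {μ : Measure α}
    {f g : α → ℝ≥0∞} (hf : AEMeasurable f μ) (hg : AEMeasurable g μ) :
    (∫⁻ x, f x * g x ∂μ) ^ 2 ≤ (∫⁻ x, f x ^ 2 ∂μ) * ∫⁻ x, g x ^ 2 ∂μ := by
  have h := ENNReal.lintegral_mul_le_Lp_mul_Lq μ Real.HolderConjugate.two_two hf hg
  have h2 := pow_le_pow_left' h 2
  refine h2.trans_eq ?_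
  rw [mul_pow, ← ENNReal.rpow_natCast, ← ENNReal.rpow_natCast, ← ENNReal.rpow_mul,
    ← ENNReal.rpow_mul]
  simp

variable {G H : Type*} [Group G] [TopologicalSpace G] [IsTopologicalGroup G] [T2Space G]
  [MeasurableSpace G] [BorelSpace G] [Group H] [TopologicalSpace H]
  [IsTopologicalGroup H] [T2Space H] [MeasurableSpace H] [BorelSpace H] {U K : Set (G × H)}
  {ϑ : H → ℝ}

/-- The weighted counting measures of strips of compact width are uniformly bounded. -/
theorem exists_weightedCount_strip_le (hU : IsOpen U) (hU1 : (1 : G × H) ∈ U)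
    (hϑ : Continuous ϑ) (hϑc : HasCompactSupport ϑ) {L : Set G} (hL : IsCompact L) :
    ∃ M : NNReal, ∀ (D : DeloneSpace U K) (g : G),
      ∫⁻ y, {y : G × H | g⁻¹ * y.1 ∈ L}.indicator 1 y ∂(weightedCount ϑ D) ≤ M := by
  obtain ⟨W, hW⟩ := hϑ.bounded_above_of_compact_support hϑc
  obtain ⟨N, hN⟩ := DeloneSpace.exists_encard_le (K := K) hU hU1 (hL.prod hϑc)
  refine ⟨N * W.toNNReal, fun D g => ?_⟩
  rw [lintegral_weightedCount]
  -- These are the only points of the strip that can carry weight; there are at most `N` of them, of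
  -- weight at most `W` each.
  set s : Set (G × H) := D.carrier ∩ (g, (1 : H)) • (L ×ˢ tsupport ϑ) with hs
  have hterm : ∀ x : D.carrier, ENNReal.ofReal (ϑ x.1.2) *
      {y : G × H | g⁻¹ * y.1 ∈ L}.indicator 1 x.1 ≤ s.indicator (fun _ => ENNReal.ofReal W) x.1 := by
    intro x
    by_cases hx : x.1 ∈ s
    · rw [indicator_of_mem hx]
      calc _ ≤ ENNReal.ofReal W * 1 := by
            gcongr
            · exact (le_abs_self _).trans (hW _)
            · by_cases h : g⁻¹ * x.1.1 ∈ L <;> simp [h]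
        _ = _ := mul_one _
    · rw [indicator_of_notMem hx, nonpos_iff_eq_zero, mul_eq_zero]
      by_cases h : g⁻¹ * x.1.1 ∈ L
      · left
        by_contra h'
        have hϑx : ϑ x.1.2 ≠ 0 := fun h0 => h' (by simp [h0])
        exact hx ⟨x.2, (g⁻¹ * x.1.1, x.1.2), ⟨h, subset_tsupport _ hϑx⟩, by ext <;> simp⟩
      · right
        exact indicator_of_notMem (s := {y : G × H | g⁻¹ * y.1 ∈ L}) h _
  calc _ ≤ ∑' x : D.carrier, s.indicator (fun _ => ENNReal.ofReal W) x.1 :=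
        ENNReal.tsum_le_tsum hterm
    _ = ∑' x : s, ENNReal.ofReal W := by
        rw [tsum_subtype D.carrier, Set.indicator_indicator, hs, ← inter_assoc, inter_self, ← hs,
          ← tsum_subtype]
    _ = s.encard * ENNReal.ofReal W := by rw [ENNReal.tsum_const]; rfl
    _ ≤ (N : ℝ≥0∞) * ENNReal.ofReal W := by
        gcongr
        have := ENat.toENNReal_mono (hN D (g, 1))
        simpa using this
    _ = _ := by simp [ENNReal.ofReal]

/-- The indicator `r` of the points within range of `x` is idempotent, so `r * ‖u‖ₑ` can be split as
`r * (r * ‖u‖ₑ)`. Cauchy–Schwarz then leaves the mass of a strip, at most `M`, times a localized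
norm of `u`. -/
theorem HasKernel.enorm_apply_sq_le {D : DeloneSpace U K} (hD : D.carrier.Countable)
    {a : (G × H) × DeloneSpace U K × (G × H) → ℂ} {C M : NNReal} {L : Set G}
    (hL : IsCompact L) (hC : ∀ p ∈ kernelDomain U K ϑ, ‖a p‖ ≤ C)
    (hfin : ∀ p ∈ kernelDomain U K ϑ, (p.1⁻¹ * p.2.2).1 ∉ L → a p = 0)
    (hM : ∀ g : G, ∫⁻ y, {y : G × H | g⁻¹ * y.1 ∈ L}.indicator 1 y ∂(weightedCount ϑ D) ≤ M)
    {T : WeightedL2 ϑ D →L[ℂ] WeightedL2 ϑ D} (hT : HasKernel ϑ a D T) (u : WeightedL2 ϑ D)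
    {x : G × H} (hx : x ∈ D.carrier) (hϑx : 0 < ϑ x.2) :
    ‖T u x‖ₑ ^ 2 ≤ C ^ 2 * (M * ∫⁻ y, {y : G × H | x.1⁻¹ * y.1 ∈ L}.indicator 1 y * ‖u y‖ₑ ^ 2
      ∂(weightedCount ϑ D)) := by
  set r : G × H → ℝ≥0∞ := {y : G × H | x.1⁻¹ * y.1 ∈ L}.indicator 1 with hr
  have hrm : Measurable r := by
    refine measurable_one.indicator ?_
    have : Continuous fun y : G => x.1⁻¹ * y := by fun_prop
    exact measurable_fst (this.measurable hL.measurableSet)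
  have hr2 : ∀ y, r y ^ 2 = r y := by
    intro y
    by_cases h : x.1⁻¹ * y.1 ∈ L <;> simp [hr, h]
  have hum : AEMeasurable (fun y => ‖u y‖ₑ) (weightedCount ϑ D) :=
    (Lp.aestronglyMeasurable u).enorm
  have h1 : ‖T u x‖ₑ ≤ C * ∫⁻ y, r y * (r y * ‖u y‖ₑ) ∂(weightedCount ϑ D) := by
    rw [← lintegral_const_mul' _ _ ENNReal.coe_ne_top]
    have hTx : T u x = ∫ y, a (x, D, y) * u y ∂(weightedCount ϑ D) :=
      (ae_weightedCount_iff hD).1 (hT u) x hx hϑx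
    rw [hTx]
    refine (enorm_integral_le_lintegral_enorm _).trans (lintegral_mono_ae ?_)
    refine (ae_weightedCount_iff hD).2 fun y hy hϑy => ?_
    have hdom : (x, D, y) ∈ kernelDomain U K ϑ :=
      ⟨hx, hy, subset_tsupport _ hϑx.ne', subset_tsupport _ hϑy.ne'⟩
    rw [← mul_assoc (r y), ← sq, hr2, ← mul_assoc, enorm_mul]
    gcongr
    by_cases h : x.1⁻¹ * y.1 ∈ L
    · have : r y = 1 := indicator_of_mem (s := {y : G × H | x.1⁻¹ * y.1 ∈ L}) h _
      rw [this, mul_one, ← ofReal_norm, ENNReal.ofReal_le_iff_le_toReal (by simp)]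
      exact hC _ hdom
    · simp [hfin _ hdom h]
  calc ‖T u x‖ₑ ^ 2 ≤ (C * ∫⁻ y, r y * (r y * ‖u y‖ₑ) ∂(weightedCount ϑ D)) ^ 2 := by gcongr
    _ = C ^ 2 * (∫⁻ y, r y * (r y * ‖u y‖ₑ) ∂(weightedCount ϑ D)) ^ 2 := mul_pow _ _ _
    _ ≤ C ^ 2 * ((∫⁻ y, r y ^ 2 ∂(weightedCount ϑ D)) *
          ∫⁻ y, (r y * ‖u y‖ₑ) ^ 2 ∂(weightedCount ϑ D)) := by
        gcongr
        exact lintegral_mul_sq_le hrm.aemeasurable (hrm.aemeasurable.mul hum)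
    _ ≤ C ^ 2 * (M * ∫⁻ y, r y * ‖u y‖ₑ ^ 2 ∂(weightedCount ϑ D)) := by
        simp only [mul_pow, hr2]
        gcongr
        exact hM x.1

theorem enorm_Lp_two_sq {α : Type*} [MeasurableSpace α] {μ : Measure α} (u : Lp ℂ 2 μ) :
    ‖u‖ₑ ^ 2 = ∫⁻ x, ‖u x‖ₑ ^ 2 ∂μ := by
  have h := eLpNorm_nnreal_pow_eq_lintegral (μ := μ) (f := u) (p := 2) (by norm_num)
  rw [Lp.enorm_def]
  simpa using h

/-- Operators with a kernel of finite type are bounded, uniformly in the Delone set. -/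
theorem IsFiniteTypeKernel.exists_opNorm_le (hU : IsOpen U) (hU1 : (1 : G × H) ∈ U)
    (hD : ∀ D : DeloneSpace U K, D.carrier.Countable) (hϑ : Continuous ϑ)
    (hϑc : HasCompactSupport ϑ) {a : (G × H) × DeloneSpace U K × (G × H) → ℂ}
    (ha : IsFiniteTypeKernel ϑ a) :
    ∃ B : ℝ, ∀ (D : DeloneSpace U K) (T : WeightedL2 ϑ D →L[ℂ] WeightedL2 ϑ D),
      HasKernel ϑ a D T → ‖T‖ ≤ B := by
  obtain ⟨C₀, hC₀⟩ := ha.bounded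
  obtain ⟨L, hL, hLi, hfin⟩ := ha.finiteRange
  obtain ⟨M, hM⟩ := exists_weightedCount_strip_le (K := K) hU hU1 hϑ hϑc hL
  set C : NNReal := C₀.toNNReal
  have hC : ∀ p ∈ kernelDomain U K ϑ, ‖a p‖ ≤ C := fun p hp =>
    (hC₀ p hp).trans (Real.le_coe_toNNReal C₀)
  refine ⟨(C * M : NNReal), fun D T hT =>
    ContinuousLinearMap.opNorm_le_bound _ (NNReal.coe_nonneg _) fun u => ?_⟩
  -- Since `L = L⁻¹`, being within range is symmetric. After interchanging the sums the inner one is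
  -- again the mass of a strip, which supplies the second factor `M`.
  have hsymm : ∀ x y : G × H, ({y : G × H | x.1⁻¹ * y.1 ∈ L}.indicator 1 y : ℝ≥0∞) =
      {x : G × H | y.1⁻¹ * x.1 ∈ L}.indicator 1 x := by
    intro x y
    have : x.1⁻¹ * y.1 ∈ L ↔ y.1⁻¹ * x.1 ∈ L := by
      conv_lhs => rw [← hLi, Set.mem_inv]
      simp
    by_cases h : x.1⁻¹ * y.1 ∈ L
    · simp [h, this.1 h]
    · simp [h, mt this.2 h]
  have key : ‖T u‖ₑ ^ 2 ≤ (((C * M : NNReal) : ℝ≥0∞) * ‖u‖ₑ) ^ 2 := by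
    rw [mul_pow, enorm_Lp_two_sq, enorm_Lp_two_sq]
    calc ∫⁻ x, ‖T u x‖ₑ ^ 2 ∂(weightedCount ϑ D)
        ≤ ∫⁻ x, C ^ 2 * (M * ∫⁻ y, {y : G × H | x.1⁻¹ * y.1 ∈ L}.indicator 1 y * ‖u y‖ₑ ^ 2
            ∂(weightedCount ϑ D)) ∂(weightedCount ϑ D) :=
          lintegral_mono_ae ((ae_weightedCount_iff (hD D)).2 fun x hx hϑx =>
            hT.enorm_apply_sq_le (hD D) hL hC hfin (hM D) u hx hϑx)
      _ = C ^ 2 * (M * ∫⁻ x, ∫⁻ y, {y : G × H | x.1⁻¹ * y.1 ∈ L}.indicator 1 y * ‖u y‖ₑ ^ 2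
            ∂(weightedCount ϑ D) ∂(weightedCount ϑ D)) := by
          rw [lintegral_const_mul' _ _ (by finiteness), lintegral_const_mul' _ _ (by finiteness)]
      _ = C ^ 2 * (M * ∫⁻ y, ‖u y‖ₑ ^ 2 * ∫⁻ x, {x : G × H | y.1⁻¹ * x.1 ∈ L}.indicator 1 x
            ∂(weightedCount ϑ D) ∂(weightedCount ϑ D)) := by
          congr 2
          simp only [lintegral_weightedCount, ← ENNReal.tsum_mul_left]
          rw [ENNReal.tsum_comm]
          refine tsum_congr fun y => tsum_congr fun x => ?_
          rw [hsymm x.1 y.1]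
          ring
      _ ≤ C ^ 2 * (M * ∫⁻ y, ‖u y‖ₑ ^ 2 * M ∂(weightedCount ϑ D)) := by
          gcongr with y
          exact hM D y.1
      _ = ((C * M : NNReal) : ℝ≥0∞) ^ 2 * ∫⁻ y, ‖u y‖ₑ ^ 2 ∂(weightedCount ϑ D) := by
          rw [lintegral_mul_const' _ _ (by finiteness)]
          push_cast
          ring
  have key' := (ENNReal.pow_le_pow_left_iff two_ne_zero).1 key
  have := ENNReal.toReal_mono (by finiteness) key'
  simpa using this

end SchurTest

/-! ### Functional calculus of a self-adjoint operator. -/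

section FunctionalCalculus

variable {E : Type*} [NormedAddCommGroup E] [InnerProductSpace ℂ E] [CompleteSpace E]
  {T : E →L[ℂ] E} {φ ψ : ℝ → ℝ}

theorem norm_functionalCalculus_sub_aeval_le (hT : IsSelfAdjoint T) (hφ : Continuous φ)
    {p : Polynomial ℝ} {ε : ℝ} (hε : 0 ≤ ε) (hp : ∀ x, |x| ≤ ‖T‖ → |p.eval x - φ x| ≤ ε) :
    ‖functionalCalculus φ T - Polynomial.aeval T p‖ ≤ ε := by
  rw [functionalCalculus, ← cfc_polynomial p T hT,
    ← cfc_sub φ p.eval T hφ.continuousOn p.continuous.continuousOn]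
  refine norm_cfc_le hε fun x hx => ?_
  rw [norm_sub_rev]
  refine hp x ((spectrum.norm_le_norm_mul_of_mem hx).trans ?_)
  -- The bound `‖1‖ ≤ 1` is used rather than equality, so that the zero space is covered.
  exact mul_le_of_le_one_right (norm_nonneg _) ContinuousLinearMap.norm_id_le

theorem functionalCalculus_add (hφ : Continuous φ) (hψ : Continuous ψ) :
    functionalCalculus (fun t => φ t + ψ t) T = functionalCalculus φ T + functionalCalculus ψ T :=
  cfc_add T φ ψ hφ.continuousOn hψ.continuousOn

theorem functionalCalculus_const_mul (c : ℝ) (hφ : Continuous φ) :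
    functionalCalculus (fun t => c * φ t) T = c • functionalCalculus φ T := by
  rw [functionalCalculus, functionalCalculus, cfc_const_mul c φ T hφ.continuousOn]

theorem re_inner_functionalCalculus_nonneg (hφ : ∀ t, 0 ≤ φ t) (u : E) :
    0 ≤ (inner ℂ u (functionalCalculus φ T u)).re := by
  have h : 0 ≤ functionalCalculus φ T := cfc_nonneg fun t _ => hφ t
  exact ((ContinuousLinearMap.nonneg_iff_isPositive _).1 h).re_inner_nonneg_right _

theorem im_inner_functionalCalculus (u : E) :
    (inner ℂ u (functionalCalculus φ T u)).im = 0 := by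
  have h : IsSelfAdjoint (functionalCalculus φ T) := cfc_predicate φ T
  exact h.isSymmetric.im_inner_self_apply u

end FunctionalCalculus

/-! ### Continuity and invariance of the diagonal coefficients of `φ(A)`. -/

section Diagonal

variable {G H : Type*} [Group G] [TopologicalSpace G] [IsTopologicalGroup G]
  [LocallyCompactSpace G] [T2Space G] [MeasurableSpace G] [BorelSpace G]
  [Group H] [TopologicalSpace H] [IsTopologicalGroup H] [T2Space H] [MeasurableSpace H]
  [BorelSpace H] {U K : Set (G × H)} {ϑ : H → ℝ}

/-- The diagonal matrix coefficient `⟨δ_x, T δ_x⟩`. -/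
def diagonal (ϑ : H → ℝ) (T : ∀ D : DeloneSpace U K, WeightedL2 ϑ D →L[ℂ] WeightedL2 ϑ D)
    (D : DeloneSpace U K) (x : G × H) : ℂ :=
  inner ℂ (delta ϑ D x) (T D (delta ϑ D x))

/-- The diagonal matrix coefficients of `T` are continuous and `G`-invariant. -/
structure HasContinuousDiagonal (ϑ : H → ℝ)
    (T : ∀ D : DeloneSpace U K, WeightedL2 ϑ D →L[ℂ] WeightedL2 ϑ D) : Prop where
  continuousOn : ContinuousOn (fun q : DeloneSpace U K × (G × H) => diagonal ϑ T q.1 q.2)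
    {q | q.2 ∈ q.1.carrier}
  invariant : ∀ (g : G) (D : DeloneSpace U K), ∀ x ∈ D.carrier,
    diagonal ϑ T (D.translate (g, (1 : H))) ((g, (1 : H)) * x) = diagonal ϑ T D x

variable {T T' : ∀ D : DeloneSpace U K, WeightedL2 ϑ D →L[ℂ] WeightedL2 ϑ D}

theorem norm_diagonal_sub_le (hϑ0 : ∀ h, 0 ≤ ϑ h) {D : DeloneSpace U K} {x : G × H}
    (hx : x ∈ D.carrier) {ε : ℝ} (h : ‖T D - T' D‖ ≤ ε) :
    ‖diagonal ϑ T D x - diagonal ϑ T' D x‖ ≤ ε * ϑ x.2 := by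
  rw [diagonal, diagonal, ← inner_sub_right, ← sub_apply]
  calc ‖inner ℂ (delta ϑ D x) ((T D - T' D) (delta ϑ D x))‖
      ≤ ‖delta ϑ D x‖ * (‖T D - T' D‖ * ‖delta ϑ D x‖) :=
        (norm_inner_le_norm _ _).trans
          (mul_le_mul_of_nonneg_left (ContinuousLinearMap.le_opNorm _ _) (norm_nonneg _))
    _ = ‖T D - T' D‖ * ‖delta ϑ D x‖ ^ 2 := by ring
    _ ≤ ε * ϑ x.2 := by
        rw [norm_delta_sq hϑ0 hx]
        exact mul_le_mul_of_nonneg_right h (hϑ0 _)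

/-- As `‖δ_x‖² = ϑ(π_H x)` is bounded, operator approximation uniform in `D` is uniform
approximation of the diagonal coefficients over all pairs `(D, x)`, and continuity and invariance
survive uniform limits. -/
theorem HasContinuousDiagonal.of_approx (hϑ : Continuous ϑ) (hϑc : HasCompactSupport ϑ)
    (hϑ0 : ∀ h, 0 ≤ ϑ h)
    (h : ∀ ε > (0 : ℝ), ∃ T' : ∀ D : DeloneSpace U K, WeightedL2 ϑ D →L[ℂ] WeightedL2 ϑ D,
      HasContinuousDiagonal ϑ T' ∧ ∀ D, ‖T D - T' D‖ ≤ ε) : HasContinuousDiagonal ϑ T := by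
  obtain ⟨W, hW⟩ := hϑ.bounded_above_of_compact_support hϑc
  have hW0 : 0 ≤ W := (norm_nonneg _).trans (hW 1)
  have key : ∀ ε > (0 : ℝ), ∃ T' : ∀ D : DeloneSpace U K, WeightedL2 ϑ D →L[ℂ] WeightedL2 ϑ D,
      HasContinuousDiagonal ϑ T' ∧ ∀ D, ∀ x ∈ D.carrier,
        dist (diagonal ϑ T D x) (diagonal ϑ T' D x) < ε := by
    intro ε hε
    obtain ⟨T', hT', hd⟩ := h (ε / (W + 1)) (by positivity)
    refine ⟨T', hT', fun D x hx => ?_⟩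
    rw [dist_eq_norm]
    calc _ ≤ ε / (W + 1) * ϑ x.2 := norm_diagonal_sub_le hϑ0 hx (hd D)
      _ ≤ ε / (W + 1) * W := by
          gcongr
          exact (le_abs_self _).trans (hW _)
      _ < ε := by
          rw [div_mul_eq_mul_div, div_lt_iff₀ (by positivity)]
          nlinarith
  refine ⟨continuousOn_of_uniform_approx_of_continuousOn fun u hu => ?_, fun g D x hx => ?_⟩
  · obtain ⟨ε, hε, hεu⟩ := Metric.mem_uniformity_dist.1 hu
    obtain ⟨T', hT', hd⟩ := key ε hε
    exact ⟨_, hT'.continuousOn, fun q hq => hεu (hd q.1 q.2 hq)⟩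
  · refine eq_of_forall_dist_le fun ε hε => ?_
    obtain ⟨T', hT', hd⟩ := key (ε / 2) (by positivity)
    have h1 := hd _ _ (DeloneSpace.mul_mem_translate (g := (g, (1 : H))).2 hx)
    have h2 := hd D x hx
    rw [hT'.invariant g D x hx] at h1
    rw [dist_comm] at h2
    have h3 := dist_triangle (diagonal ϑ T (D.translate (g, (1 : H))) ((g, (1 : H)) * x))
      (diagonal ϑ T' D x) (diagonal ϑ T D x)
    linarith

theorem HasContinuousDiagonal.one (hϑ : Continuous ϑ) (hϑ0 : ∀ h, 0 ≤ ϑ h) :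
    HasContinuousDiagonal ϑ fun _ : DeloneSpace U K => 1 := by
  classical
  have h : ∀ D : DeloneSpace U K, ∀ x ∈ D.carrier, diagonal ϑ (fun _ => 1) D x = ϑ x.2 :=
    fun D x hx => by
      rw [diagonal, one_apply_eq_self, inner_delta_delta hϑ0 hx, if_pos rfl]
  refine ⟨?_, fun g D x hx => ?_⟩
  · exact ContinuousOn.congr (f := fun q => (ϑ q.2.2 : ℂ)) (by fun_prop) fun q hq => h q.1 q.2 hq
  · rw [h D x hx, h _ _ (DeloneSpace.mul_mem_translate.2 hx)]
    simp

theorem HasContinuousDiagonal.zero :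
    HasContinuousDiagonal ϑ fun _ : DeloneSpace U K => 0 := by
  constructor <;> simp [diagonal, continuousOn_const]

theorem HasContinuousDiagonal.add (hT : HasContinuousDiagonal ϑ T)
    (hT' : HasContinuousDiagonal ϑ T') : HasContinuousDiagonal ϑ fun D => T D + T' D := by
  have h : ∀ D x, diagonal ϑ (fun D => T D + T' D) D x = diagonal ϑ T D x + diagonal ϑ T' D x :=
    fun D x => by simp [diagonal, inner_add_right]
  refine ⟨?_, fun g D x hx => ?_⟩
  · simp only [h]
    exact hT.continuousOn.add hT'.continuousOn
  · rw [h, h, hT.invariant g D x hx, hT'.invariant g D x hx]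

theorem HasContinuousDiagonal.real_smul (hT : HasContinuousDiagonal ϑ T) (c : ℝ) :
    HasContinuousDiagonal ϑ fun D => c • T D := by
  have h : ∀ D x, diagonal ϑ (fun D => c • T D) D x = c * diagonal ϑ T D x := by
    intro D x
    have : (c • T D) (delta ϑ D x) = (c : ℂ) • T D (delta ϑ D x) := by
      rw [Complex.coe_smul]
      rfl
    rw [diagonal, this, inner_smul_right, diagonal]
  refine ⟨?_, fun g D x hx => ?_⟩
  · simp only [h]
    exact continuousOn_const.mul hT.continuousOn
  · rw [h, h, hT.invariant g D x hx]

theorem HasContinuousDiagonal.sum {ι : Type*} (s : Finset ι)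
    {P : ι → ∀ D : DeloneSpace U K, WeightedL2 ϑ D →L[ℂ] WeightedL2 ϑ D}
    (h : ∀ i ∈ s, HasContinuousDiagonal ϑ (P i)) :
    HasContinuousDiagonal ϑ fun D => ∑ i ∈ s, P i D := by
  classical
  induction s using Finset.induction_on with
  | empty => simpa using HasContinuousDiagonal.zero
  | insert i s his ih =>
    simp only [Finset.sum_insert his]
    exact (h i (Finset.mem_insert_self i s)).add
      (ih fun j hj => h j (Finset.mem_insert_of_mem hj))

theorem IsKernelOf.hasContinuousDiagonal (hϑ : Continuous ϑ)
    {a : (G × H) × DeloneSpace U K × (G × H) → ℂ} (ha : IsKernelOf ϑ a T) :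
    HasContinuousDiagonal ϑ T := by
  obtain ⟨C, hC⟩ := ha.bounded
  have h : ∀ D : DeloneSpace U K, ∀ x ∈ D.carrier,
      diagonal ϑ T D x = ϑ x.2 * (a (x, D, x) * ϑ x.2) :=
    fun D x hx => ha.inner_delta D x hx x hx
  refine ⟨?_, fun g D x hx => ?_⟩
  · have h1 : ContinuousOn (fun q : DeloneSpace U K × (G × H) => a (q.2, q.1, q.2) * ϑ q.2.2)
        {q | q.2 ∈ q.1.carrier} := by
      refine ContinuousOn.mul_of_bounded (C := C) (ha.continuousOn.comp (by fun_prop) ?_) ?_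
        (by fun_prop)
      · exact fun q hq => ⟨hq.1, hq.1, fun h => hq.2 (by simp [h]), fun h => hq.2 (by simp [h])⟩
      · exact fun q hq =>
          hC _ ⟨hq.1, hq.1, fun h => hq.2 (by simp [h]), fun h => hq.2 (by simp [h])⟩
    refine ContinuousOn.congr (ContinuousOn.mul (f := fun q => (ϑ q.2.2 : ℂ)) (by fun_prop) h1)
      fun q hq => h q.1 q.2 hq
  · rw [h D x hx, h _ _ (DeloneSpace.mul_mem_translate.2 hx)]
    by_cases hϑx : ϑ x.2 = 0
    · simp [hϑx]
    · rw [ha.invariant g x D x ⟨hx, hx, hϑx, hϑx⟩]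
      simp

/-- The family `T` is a uniform limit of families with a kernel. -/
def IsKernelLimit (ϑ : H → ℝ)
    (T : ∀ D : DeloneSpace U K, WeightedL2 ϑ D →L[ℂ] WeightedL2 ϑ D) : Prop :=
  ∀ ε > (0 : ℝ), ∃ (a : (G × H) × DeloneSpace U K × (G × H) → ℂ)
    (B : ∀ D : DeloneSpace U K, WeightedL2 ϑ D →L[ℂ] WeightedL2 ϑ D),
    IsKernelOf ϑ a B ∧ ∀ D, ‖T D - B D‖ ≤ ε

theorem IsKernelLimit.hasContinuousDiagonal (hϑ : Continuous ϑ) (hϑc : HasCompactSupport ϑ)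
    (hϑ0 : ∀ h, 0 ≤ ϑ h) (h : IsKernelLimit ϑ T) : HasContinuousDiagonal ϑ T :=
  HasContinuousDiagonal.of_approx hϑ hϑc hϑ0 fun ε hε => by
    obtain ⟨a, B, ha, hB⟩ := h ε hε
    exact ⟨B, ha.hasContinuousDiagonal hϑ, hB⟩

theorem IsKernelLimit.mul (hU : IsOpen U) (hU1 : (1 : G × H) ∈ U)
    (hD : ∀ D : DeloneSpace U K, D.carrier.Countable) (hϑ : Continuous ϑ)
    (hϑc : HasCompactSupport ϑ) (hϑ0 : ∀ h, 0 ≤ ϑ h) (hT : IsKernelLimit ϑ T)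
    (hT' : IsKernelLimit ϑ T') {R : ℝ} (hR : ∀ D, ‖T D‖ ≤ R) (hR' : ∀ D, ‖T' D‖ ≤ R) :
    IsKernelLimit ϑ fun D => T D * T' D := by
  intro ε hε
  -- The bound `δ ≤ 1` gives `‖B' D‖ ≤ |R| + 1`; the other bound makes the total error `|R| * δ + δ
  -- * (|R| + 1)` at most `ε`.
  set δ : ℝ := min 1 (ε / (2 * |R| + 1)) with hδ
  have hδ0 : 0 < δ := lt_min one_pos (by positivity)
  obtain ⟨a, B, ha, hB⟩ := hT δ hδ0
  obtain ⟨a', B', ha', hB'⟩ := hT' δ hδ0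
  refine ⟨_, _, ha.mul hU hU1 hD hϑ hϑc hϑ0 ha', fun D => ?_⟩
  have hBn : ‖B' D‖ ≤ |R| + 1 := by
    have h1 : ‖B' D‖ ≤ ‖T' D‖ + ‖T' D - B' D‖ := norm_le_norm_add_norm_sub _ _
    have h2 := hR' D
    have h3 := hB' D
    have h4 : δ ≤ 1 := min_le_left _ _
    have h5 := le_abs_self R
    linarith
  calc ‖T D * T' D - B D * B' D‖ = ‖T D * (T' D - B' D) + (T D - B D) * B' D‖ := by
        congr 1
        noncomm_ring
    _ ≤ ‖T D‖ * ‖T' D - B' D‖ + ‖T D - B D‖ * ‖B' D‖ :=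
        (norm_add_le _ _).trans (add_le_add (norm_mul_le _ _) (norm_mul_le _ _))
    _ ≤ |R| * δ + δ * (|R| + 1) := by
        gcongr
        · exact (hR D).trans (le_abs_self R)
        · exact hB' D
        · exact hB D
    _ = δ * (2 * |R| + 1) := by ring
    _ ≤ ε := by
        rw [← le_div_iff₀ (by positivity)]
        exact min_le_right _ _

/-- The exponent starts at one: the identity would need the kernel `1/ϑ` on the diagonal, which is
unbounded in general. The zeroth power is covered by `HasContinuousDiagonal.one`. -/
theorem IsKernelLimit.pow (hU : IsOpen U) (hU1 : (1 : G × H) ∈ U)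
    (hD : ∀ D : DeloneSpace U K, D.carrier.Countable) (hϑ : Continuous ϑ)
    (hϑc : HasCompactSupport ϑ) (hϑ0 : ∀ h, 0 ≤ ϑ h) (hT : IsKernelLimit ϑ T) {R : ℝ}
    (hR : ∀ D, ‖T D‖ ≤ R) (n : ℕ) : IsKernelLimit ϑ fun D => T D ^ (n + 1) := by
  induction n with
  | zero => simpa using hT
  | succ n ih =>
    have h : ∀ D, ‖T D ^ (n + 1)‖ ≤ |R| ^ (n + 1) := fun D =>
      (norm_pow_le' _ n.succ_pos).trans
        (pow_le_pow_left₀ (norm_nonneg _) ((hR D).trans (le_abs_self R)) _)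
    simp only [pow_succ _ (n + 1)]
    exact ih.mul hU hU1 hD hϑ hϑc hϑ0 hT (fun D => (h D).trans (le_max_left _ R))
      fun D => (hR D).trans (le_max_right _ _)

theorem IsRandomBoundedOperator.isKernelLimit
    (hD : ∀ D : DeloneSpace U K, D.carrier.Countable) (hϑ0 : ∀ h, 0 ≤ ϑ h)
    (hT : IsRandomBoundedOperator ϑ T) : IsKernelLimit ϑ T := by
  intro ε hε
  obtain ⟨a, B, ha, haB, hB⟩ := hT ε hε
  exact ⟨a, B, ha.isKernelOf hϑ0 hD haB, hB⟩

theorem IsRandomBoundedOperator.exists_norm_le (hU : IsOpen U) (hU1 : (1 : G × H) ∈ U)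
    (hD : ∀ D : DeloneSpace U K, D.carrier.Countable) (hϑ : Continuous ϑ)
    (hϑc : HasCompactSupport ϑ) (hT : IsRandomBoundedOperator ϑ T) : ∃ R, ∀ D, ‖T D‖ ≤ R := by
  obtain ⟨a, B, ha, haB, hB⟩ := hT 1 one_pos
  obtain ⟨M, hM⟩ := ha.exists_opNorm_le hU hU1 hD hϑ hϑc
  refine ⟨M + 1, fun D => ?_⟩
  have h1 := norm_le_norm_add_norm_sub' (T D) (B D)
  have h2 := hM D _ (haB D)
  have h3 := hB D
  linarith

/-- The diagonal matrix coefficients of `φ(A)` are continuous and invariant. -/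
theorem IsRandomBoundedOperator.hasContinuousDiagonal (hU : IsOpen U) (hU1 : (1 : G × H) ∈ U)
    (hD : ∀ D : DeloneSpace U K, D.carrier.Countable) (hϑ : Continuous ϑ)
    (hϑc : HasCompactSupport ϑ) (hϑ0 : ∀ h, 0 ≤ ϑ h) (hT : IsRandomBoundedOperator ϑ T)
    (hsa : ∀ D, IsSelfAdjoint (T D)) {φ : ℝ → ℝ} (hφ : Continuous φ) :
    HasContinuousDiagonal ϑ fun D => functionalCalculus φ (T D) := by
  obtain ⟨R, hR⟩ := hT.exists_norm_le hU hU1 hD hϑ hϑc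
  have hpow : ∀ n, HasContinuousDiagonal ϑ fun D => T D ^ n := by
    intro n
    cases n with
    | zero => simpa using HasContinuousDiagonal.one hϑ hϑ0
    | succ n => exact ((hT.isKernelLimit hD hϑ0).pow hU hU1 hD hϑ hϑc hϑ0 hR
        n).hasContinuousDiagonal hϑ hϑc hϑ0
  refine HasContinuousDiagonal.of_approx hϑ hϑc hϑ0 fun ε hε => ?_
  -- All spectra lie in `[-R, R]`, so one Weierstrass polynomial serves every `D`.
  obtain ⟨p, hp⟩ := exists_polynomial_near_of_continuousOn (-R) R φ hφ.continuousOn ε hε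
  refine ⟨fun D => Polynomial.aeval (T D) p, ?_, fun D => ?_⟩
  · simp only [Polynomial.aeval_eq_sum_range]
    exact HasContinuousDiagonal.sum _ fun i _ => (hpow i).real_smul _
  · refine norm_functionalCalculus_sub_aeval_le (hsa D) hφ hε.le fun x hx => ?_
    exact (hp x (abs_le.1 (hx.trans (hR D)))).le

end Diagonal

/-! ### The functional of the Pastur–Shubin formula -/

section PasturShubin

variable {G H : Type*} [Group G] [TopologicalSpace G] [IsTopologicalGroup G]
  [LocallyCompactSpace G] [T2Space G] [MeasurableSpace G] [BorelSpace G]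
  [Group H] [TopologicalSpace H] [IsTopologicalGroup H] [T2Space H] [MeasurableSpace H]
  [BorelSpace H] {U K : Set (G × H)} {ϑ : H → ℝ}

/-- The sum `∑ x ∈ D, ρ(π_G x) ⟨δ_x, φ(T_D) δ_x⟩`. -/
def diagonalSum (ϑ : H → ℝ) (T : ∀ D : DeloneSpace U K, WeightedL2 ϑ D →L[ℂ] WeightedL2 ϑ D)
    (ρ : G → ℝ) (φ : ℝ → ℝ) (D : DeloneSpace U K) : ℝ :=
  ∑' x : D.carrier, ρ x.1.1 * (diagonal ϑ (fun D => functionalCalculus φ (T D)) D x).re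

variable {T : ∀ D : DeloneSpace U K, WeightedL2 ϑ D →L[ℂ] WeightedL2 ϑ D} {ρ ρ' : G → ℝ}
  {φ ψ : ℝ → ℝ}

/-- For real `φ` the operator `φ(T_D)` is self-adjoint, so its diagonal coefficients are real. -/
theorem pasturShubin_eq_integral_diagonalSum (μ : Measure (DeloneSpace U K)) :
    pasturShubin ϑ T μ ρ φ = ((∫ D, diagonalSum ϑ T ρ φ D ∂μ : ℝ) : ℂ) := by
  rw [pasturShubin, ← integral_complex_ofReal]
  refine integral_congr_ae (Eventually.of_forall fun D => ?_)
  simp only [diagonalSum, Complex.ofReal_tsum]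
  refine tsum_congr fun x => ?_
  have h : (diagonal ϑ (fun D => functionalCalculus φ (T D)) D x.1).im = 0 :=
    im_inner_functionalCalculus _
  rw [Complex.ofReal_mul]
  congr 1
  exact Complex.ext rfl (h.trans (Complex.ofReal_im _).symm)

theorem diagonal_eq_zero (hϑ0 : ∀ h, 0 ≤ ϑ h)
    (T : ∀ D : DeloneSpace U K, WeightedL2 ϑ D →L[ℂ] WeightedL2 ϑ D) {D : DeloneSpace U K}
    {x : G × H} (hx : x ∈ D.carrier) (h : ϑ x.2 = 0) : diagonal ϑ T D x = 0 := by
  simp [diagonal, delta_eq_zero hϑ0 hx h]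

theorem mul_re_diagonal_eq_zero (hϑ0 : ∀ h, 0 ≤ ϑ h)
    (T : ∀ D : DeloneSpace U K, WeightedL2 ϑ D →L[ℂ] WeightedL2 ϑ D) {D : DeloneSpace U K}
    {x : G × H} (hx : x ∈ D.carrier) (h : x ∉ tsupport ρ ×ˢ tsupport ϑ) :
    ρ x.1 * (diagonal ϑ T D x).re = 0 := by
  by_cases h1 : ρ x.1 = 0
  · rw [h1, zero_mul]
  · have h2 : ϑ x.2 = 0 := by
      by_contra h2
      exact h ⟨subset_tsupport _ h1, subset_tsupport _ h2⟩
    rw [diagonal_eq_zero hϑ0 T hx h2, Complex.zero_re, mul_zero]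

theorem continuous_diagonalSum (hU : IsOpen U) (hU1 : (1 : G × H) ∈ U)
    (hD : ∀ D : DeloneSpace U K, D.carrier.Countable) (hϑ : Continuous ϑ)
    (hϑc : HasCompactSupport ϑ) (hϑ0 : ∀ h, 0 ≤ ϑ h) (hT : IsRandomBoundedOperator ϑ T)
    (hsa : ∀ D, IsSelfAdjoint (T D)) (hρ : Continuous ρ) (hρc : HasCompactSupport ρ)
    (hφ : Continuous φ) : Continuous (diagonalSum ϑ T ρ φ) := by
  have hdiag := hT.hasContinuousDiagonal hU hU1 hD hϑ hϑc hϑ0 hsa hφ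
  refine continuous_iff_continuousAt.2 fun D₀ => ?_
  refine DeloneSpace.continuousAt_tsum hU hU1 (𝒟 := id)
    (f := fun D z => ρ z.1 * (diagonal ϑ (fun D => functionalCalculus φ (T D)) D z).re)
    continuousAt_id (IsCompact.prod hρc hϑc)
    (Eventually.of_forall fun D z hz hzC => mul_re_diagonal_eq_zero hϑ0 _ hz hzC) fun z hz => ?_
  have h : ContinuousOn (fun q : DeloneSpace U K × (G × H) => ρ q.2.1 *
      (diagonal ϑ (fun D => functionalCalculus φ (T D)) q.1 q.2).re) {q | q.2 ∈ q.1.carrier} :=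
    ContinuousOn.mul (f := fun q => ρ q.2.1) (by fun_prop)
      (Complex.continuous_re.comp_continuousOn hdiag.continuousOn)
  exact h (D₀, z) hz

theorem summable_diagonalSum (hU : IsOpen U) (hU1 : (1 : G × H) ∈ U)
    (hϑc : HasCompactSupport ϑ) (hϑ0 : ∀ h, 0 ≤ ϑ h) (hρc : HasCompactSupport ρ)
    (T : ∀ D : DeloneSpace U K, WeightedL2 ϑ D →L[ℂ] WeightedL2 ϑ D) (D : DeloneSpace U K) :
    Summable fun x : D.carrier => ρ x.1.1 * (diagonal ϑ T D x).re := by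
  have hfin := DeloneSpace.finite_inter hU hU1 (IsCompact.prod hρc hϑc) D
  refine summable_of_hasFiniteSupport ((hfin.preimage Subtype.val_injective.injOn).subset ?_)
  intro x hx
  refine ⟨x.2, ?_⟩
  by_contra h
  exact hx (mul_re_diagonal_eq_zero hϑ0 T x.2 h)

theorem diagonalSum_add_left (hU : IsOpen U) (hU1 : (1 : G × H) ∈ U)
    (hϑc : HasCompactSupport ϑ) (hϑ0 : ∀ h, 0 ≤ ϑ h) (hρc : HasCompactSupport ρ)
    (hρ'c : HasCompactSupport ρ') (D : DeloneSpace U K) :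
    diagonalSum ϑ T (fun g => ρ g + ρ' g) φ D =
      diagonalSum ϑ T ρ φ D + diagonalSum ϑ T ρ' φ D := by
  rw [diagonalSum, diagonalSum, diagonalSum, ← Summable.tsum_add
    (summable_diagonalSum hU hU1 hϑc hϑ0 hρc _ D) (summable_diagonalSum hU hU1 hϑc hϑ0 hρ'c _ D)]
  exact tsum_congr fun x => by ring

theorem diagonalSum_const_mul_left (c : ℝ) (D : DeloneSpace U K) :
    diagonalSum ϑ T (fun g => c * ρ g) φ D = c * diagonalSum ϑ T ρ φ D := by
  rw [diagonalSum, diagonalSum, ← tsum_mul_left]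
  exact tsum_congr fun x => by ring

theorem diagonalSum_add_right (hU : IsOpen U) (hU1 : (1 : G × H) ∈ U)
    (hϑc : HasCompactSupport ϑ) (hϑ0 : ∀ h, 0 ≤ ϑ h) (hρc : HasCompactSupport ρ)
    (hφ : Continuous φ) (hψ : Continuous ψ) (D : DeloneSpace U K) :
    diagonalSum ϑ T ρ (fun t => φ t + ψ t) D =
      diagonalSum ϑ T ρ φ D + diagonalSum ϑ T ρ ψ D := by
  rw [diagonalSum, diagonalSum, diagonalSum, ← Summable.tsum_add
    (summable_diagonalSum hU hU1 hϑc hϑ0 hρc _ D) (summable_diagonalSum hU hU1 hϑc hϑ0 hρc _ D)]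
  refine tsum_congr fun x => ?_
  simp only [diagonal, functionalCalculus_add hφ hψ, add_apply, inner_add_right, Complex.add_re]
  ring

theorem re_inner_real_smul_apply {E : Type*} [NormedAddCommGroup E] [InnerProductSpace ℂ E]
    (c : ℝ) (S : E →L[ℂ] E) (u : E) : (inner ℂ u ((c • S) u)).re = c * (inner ℂ u (S u)).re := by
  have : (c • S) u = (c : ℂ) • S u := by
    rw [Complex.coe_smul]
    rfl
  rw [this, inner_smul_right, Complex.re_ofReal_mul]

theorem diagonalSum_const_mul_right (hφ : Continuous φ) (c : ℝ) (D : DeloneSpace U K) :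
    diagonalSum ϑ T ρ (fun t => c * φ t) D = c * diagonalSum ϑ T ρ φ D := by
  rw [diagonalSum, diagonalSum, ← tsum_mul_left]
  refine tsum_congr fun x => ?_
  rw [diagonal, functionalCalculus_const_mul c hφ, re_inner_real_smul_apply, diagonal]
  ring

theorem diagonalSum_nonneg (hρ : ∀ g, 0 ≤ ρ g) (hφ : ∀ t, 0 ≤ φ t) (D : DeloneSpace U K) :
    0 ≤ diagonalSum ϑ T ρ φ D :=
  tsum_nonneg fun _ => mul_nonneg (hρ _) (re_inner_functionalCalculus_nonneg hφ _)

/-- A translation of `D` is absorbed by `ρ`; this converts invariance of `μ` into left invariance in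
`ρ`. -/
theorem diagonalSum_translate (hU : IsOpen U) (hU1 : (1 : G × H) ∈ U)
    (hD : ∀ D : DeloneSpace U K, D.carrier.Countable) (hϑ : Continuous ϑ)
    (hϑc : HasCompactSupport ϑ) (hϑ0 : ∀ h, 0 ≤ ϑ h) (hT : IsRandomBoundedOperator ϑ T)
    (hsa : ∀ D, IsSelfAdjoint (T D)) (hφ : Continuous φ) (g : G) (D : DeloneSpace U K) :
    diagonalSum ϑ T ρ φ (D.translate (g, (1 : H))) = diagonalSum ϑ T (fun x => ρ (g * x)) φ D := by
  have hdiag := hT.hasContinuousDiagonal hU hU1 hD hϑ hϑc hϑ0 hsa hφ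
  rw [diagonalSum, DeloneSpace.tsum_translate (g, (1 : H)) D fun x =>
    ρ x.1 * (diagonal ϑ (fun D => functionalCalculus φ (T D)) (D.translate (g, 1)) x).re]
  exact tsum_congr fun x => by rw [hdiag.invariant g D x x.2]; rfl

end PasturShubin

/-! ### Existence and uniqueness of the density of states -/

/-- A left-invariant positive linear functional on `C_c(G)` is a multiple of the Haar integral. -/
theorem exists_eq_mul_integral_of_mulLeftInvariant {G : Type*} [Group G] [TopologicalSpace G]
    [IsTopologicalGroup G] [LocallyCompactSpace G] [T2Space G] [MeasurableSpace G]
    [BorelSpace G] (m : Measure G) [m.IsHaarMeasure] (Λ : C_c(G, ℝ) →ₚ[ℝ] ℝ)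
    (hΛ : ∀ (g : G) (f f' : C_c(G, ℝ)), (∀ x, f' x = f (g * x)) → Λ f' = Λ f) :
    ∃ c : ℝ, ∀ f : C_c(G, ℝ), Λ f = c * ∫ x, f x ∂m := by
  have hinv : (RealRMK.rieszMeasure Λ).IsMulLeftInvariant := by
    refine ⟨fun g => ?_⟩
    have : (Measure.map (g * ·) (RealRMK.rieszMeasure Λ)).Regular :=
      Measure.Regular.map (Homeomorph.mulLeft g)
    refine Measure.ext_of_integral_eq_on_compactlySupported fun f => ?_
    have h2 := (Homeomorph.mulLeft g).measurableEmbedding.integral_map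
      (μ := RealRMK.rieszMeasure Λ) (f : G → ℝ)
    refine h2.trans ?_
    let f' : C_c(G, ℝ) := ⟨⟨fun x => f (g * x), by fun_prop⟩,
      f.hasCompactSupport.comp_homeomorph (Homeomorph.mulLeft g)⟩
    have h3 := hΛ g f f' fun _ => rfl
    rw [← RealRMK.integral_rieszMeasure, ← RealRMK.integral_rieszMeasure] at h3
    exact h3
  obtain ⟨c, hc⟩ := Measure.exists_integral_isMulLeftInvariant_eq_smul_of_hasCompactSupport
    (RealRMK.rieszMeasure Λ) m
  refine ⟨c, fun f => ?_⟩
  rw [← RealRMK.integral_rieszMeasure, hc f f.continuous f.hasCompactSupport,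
    integral_smul_nnreal_measure]
  rfl

theorem exists_integral_eq_one {G : Type*} [Group G] [TopologicalSpace G]
    [IsTopologicalGroup G] [LocallyCompactSpace G] [MeasurableSpace G]
    [BorelSpace G] (m : Measure G) [m.IsHaarMeasure] :
    ∃ ρ : G → ℝ, Continuous ρ ∧ HasCompactSupport ρ ∧ (∀ g, 0 ≤ ρ g) ∧ ∫ g, ρ g ∂m = 1 := by
  obtain ⟨f, hfc, hf0, hf1⟩ := exists_continuous_nonneg_pos (1 : G)
  have hpos : 0 < ∫ g, f g ∂m :=
    f.continuous.integral_pos_of_hasCompactSupport_nonneg_nonzero hfc hf0 hf1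
  refine ⟨fun g => (∫ g, f g ∂m)⁻¹ * f g, by fun_prop, hfc.mul_left, fun g => ?_, ?_⟩
  · exact mul_nonneg (inv_nonneg.2 hpos.le) (hf0 g)
  · rw [integral_const_mul, inv_mul_cancel₀ hpos.ne']

section Existence

variable {G H : Type*} [Group G] [TopologicalSpace G] [IsTopologicalGroup G]
  [LocallyCompactSpace G] [T2Space G] [MeasurableSpace G] [BorelSpace G]
  [Group H] [TopologicalSpace H] [IsTopologicalGroup H] [T2Space H] [MeasurableSpace H]
  [BorelSpace H] {U K : Set (G × H)} {ϑ : H → ℝ}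
  {T : ∀ D : DeloneSpace U K, WeightedL2 ϑ D →L[ℂ] WeightedL2 ϑ D} {ρ ρ' : G → ℝ}
  {φ ψ : ℝ → ℝ} {μ : Measure (DeloneSpace U K)}

theorem integral_diagonalSum_comp_mul_left (hU : IsOpen U) (hU1 : (1 : G × H) ∈ U)
    (hD : ∀ D : DeloneSpace U K, D.carrier.Countable) (hϑ : Continuous ϑ)
    (hϑc : HasCompactSupport ϑ) (hϑ0 : ∀ h, 0 ≤ ϑ h) (hT : IsRandomBoundedOperator ϑ T)
    (hsa : ∀ D, IsSelfAdjoint (T D)) (hρ : Continuous ρ) (hρc : HasCompactSupport ρ)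
    (hφ : Continuous φ) {g : G} (hμ : μ.map (fun D => D.translate (g, (1 : H))) = μ) :
    ∫ D, diagonalSum ϑ T (fun x => ρ (g * x)) φ D ∂μ = ∫ D, diagonalSum ϑ T ρ φ D ∂μ := by
  have hc := continuous_diagonalSum hU hU1 hD hϑ hϑc hϑ0 hT hsa hρ hρc hφ
  conv_rhs => rw [← hμ]
  rw [integral_map (DeloneSpace.continuous_translate (g, (1 : H))).measurable.aemeasurable
    hc.aestronglyMeasurable]
  simp only [diagonalSum_translate hU hU1 hD hϑ hϑc hϑ0 hT hsa hφ]

variable [CompactSpace (DeloneSpace U K)] [IsFiniteMeasure μ]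

theorem integrable_diagonalSum (hU : IsOpen U) (hU1 : (1 : G × H) ∈ U)
    (hD : ∀ D : DeloneSpace U K, D.carrier.Countable) (hϑ : Continuous ϑ)
    (hϑc : HasCompactSupport ϑ) (hϑ0 : ∀ h, 0 ≤ ϑ h) (hT : IsRandomBoundedOperator ϑ T)
    (hsa : ∀ D, IsSelfAdjoint (T D)) (hρ : Continuous ρ) (hρc : HasCompactSupport ρ)
    (hφ : Continuous φ) : Integrable (diagonalSum ϑ T ρ φ) μ :=
  (continuous_diagonalSum hU hU1 hD hϑ hϑc hϑ0 hT hsa hρ hρc hφ).integrable_of_hasCompactSupport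
    (HasCompactSupport.of_compactSpace _)

/-- The constant depends on `φ` and `μ` but not on `ρ`, which is the independence of `ρ` in the
density of states. Positivity of `φ` makes the functional of `ρ` positive. -/
theorem integral_diagonalSum_eq_of_nonneg (m : Measure G) [m.IsHaarMeasure] (hU : IsOpen U)
    (hU1 : (1 : G × H) ∈ U)
    (hD : ∀ D : DeloneSpace U K, D.carrier.Countable) (hϑ : Continuous ϑ)
    (hϑc : HasCompactSupport ϑ) (hϑ0 : ∀ h, 0 ≤ ϑ h) (hT : IsRandomBoundedOperator ϑ T)
    (hsa : ∀ D, IsSelfAdjoint (T D)) (hφ : Continuous φ) (hφ0 : ∀ t, 0 ≤ φ t)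
    (hμ : ∀ g : G, μ.map (fun D => D.translate (g, (1 : H))) = μ) :
    ∃ c : ℝ, ∀ ρ : G → ℝ, Continuous ρ → HasCompactSupport ρ →
      ∫ D, diagonalSum ϑ T ρ φ D ∂μ = c * ∫ x, ρ x ∂m := by
  have hint : ∀ f : C_c(G, ℝ), Integrable (diagonalSum ϑ T f φ) μ := fun f =>
    integrable_diagonalSum hU hU1 hD hϑ hϑc hϑ0 hT hsa f.continuous f.hasCompactSupport hφ
  let Λ₀ : C_c(G, ℝ) →ₗ[ℝ] ℝ :=
    { toFun := fun f => ∫ D, diagonalSum ϑ T f φ D ∂μ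
      map_add' := fun f f' => by
        rw [← integral_add (hint f) (hint f')]
        exact integral_congr_ae (Eventually.of_forall fun D =>
          diagonalSum_add_left hU hU1 hϑc hϑ0 f.hasCompactSupport f'.hasCompactSupport D)
      map_smul' := fun c f => by
        rw [RingHom.id_apply, smul_eq_mul, ← integral_const_mul]
        exact integral_congr_ae (Eventually.of_forall fun D => diagonalSum_const_mul_left c D) }
  let Λ : C_c(G, ℝ) →ₚ[ℝ] ℝ := PositiveLinearMap.mk₀ Λ₀ fun f hf =>
    integral_nonneg fun D => diagonalSum_nonneg (fun g => hf g) hφ0 D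
  obtain ⟨c, hc⟩ := exists_eq_mul_integral_of_mulLeftInvariant m Λ fun g f f' hff' => by
    have h : (f' : G → ℝ) = fun x => f (g * x) := funext hff'
    change ∫ D, diagonalSum ϑ T f' φ D ∂μ = ∫ D, diagonalSum ϑ T f φ D ∂μ
    rw [h]
    exact integral_diagonalSum_comp_mul_left hU hU1 hD hϑ hϑc hϑ0 hT hsa f.continuous
      f.hasCompactSupport hφ (hμ g)
  exact ⟨c, fun ρ hρ hρc => hc ⟨⟨ρ, hρ⟩, hρc⟩⟩

theorem integral_diagonalSum_eq (m : Measure G) [m.IsHaarMeasure] (hU : IsOpen U)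
    (hU1 : (1 : G × H) ∈ U)
    (hD : ∀ D : DeloneSpace U K, D.carrier.Countable) (hϑ : Continuous ϑ)
    (hϑc : HasCompactSupport ϑ) (hϑ0 : ∀ h, 0 ≤ ϑ h) (hT : IsRandomBoundedOperator ϑ T)
    (hsa : ∀ D, IsSelfAdjoint (T D)) (hφ : Continuous φ)
    (hμ : ∀ g : G, μ.map (fun D => D.translate (g, (1 : H))) = μ) :
    ∃ c : ℝ, ∀ ρ : G → ℝ, Continuous ρ → HasCompactSupport ρ →
      ∫ D, diagonalSum ϑ T ρ φ D ∂μ = c * ∫ x, ρ x ∂m := by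
  have hp : Continuous fun t => max (φ t) 0 := by fun_prop
  have hn : Continuous fun t => max (-φ t) 0 := by fun_prop
  obtain ⟨c₁, h₁⟩ := integral_diagonalSum_eq_of_nonneg m hU hU1 hD hϑ hϑc hϑ0 hT hsa hp
    (fun t => le_max_right _ _) hμ
  obtain ⟨c₂, h₂⟩ := integral_diagonalSum_eq_of_nonneg m hU hU1 hD hϑ hϑc hϑ0 hT hsa hn
    (fun t => le_max_right _ _) hμ
  refine ⟨c₁ - c₂, fun ρ hρ hρc => ?_⟩
  -- The decomposition into positive and negative parts is written as `φ⁺ = φ + φ⁻`, so that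
  -- additivity suffices.
  have h : (fun t => max (φ t) 0) = fun t => φ t + max (-φ t) 0 := by
    funext t
    rcases le_total (φ t) 0 with ht | ht
    · rw [max_eq_right ht, max_eq_left (neg_nonneg.2 ht), add_neg_cancel]
    · rw [max_eq_left ht, max_eq_right (neg_nonpos.2 ht), add_zero]
  have h₃ := h₁ ρ hρ hρc
  rw [h] at h₃
  simp only [diagonalSum_add_right hU hU1 hϑc hϑ0 hρc hφ hn] at h₃
  rw [integral_add (integrable_diagonalSum hU hU1 hD hϑ hϑc hϑ0 hT hsa hρ hρc hφ)
    (integrable_diagonalSum hU hU1 hD hϑ hϑc hϑ0 hT hsa hρ hρc hn), h₂ ρ hρ hρc] at h₃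
  linarith

/-- The density of states exists and is unique. -/
theorem existsUnique_isDensityOfStates (m : Measure G) [m.IsHaarMeasure] (hU : IsOpen U)
    (hU1 : (1 : G × H) ∈ U)
    (hD : ∀ D : DeloneSpace U K, D.carrier.Countable) (hϑ : Continuous ϑ)
    (hϑc : HasCompactSupport ϑ) (hϑ0 : ∀ h, 0 ≤ ϑ h) (hT : IsRandomBoundedOperator ϑ T)
    (hsa : ∀ D, IsSelfAdjoint (T D))
    (hμ : ∀ g : G, μ.map (fun D => D.translate (g, (1 : H))) = μ) :
    ∃! η : Measure ℝ, IsDensityOfStates m ϑ T μ η := by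
  obtain ⟨ρ₀, hρ₀, hρ₀c, hρ₀0, hρ₀1⟩ := exists_integral_eq_one m
  have hint : ∀ f : C_c(ℝ, ℝ), Integrable (diagonalSum ϑ T ρ₀ f) μ := fun f =>
    integrable_diagonalSum hU hU1 hD hϑ hϑc hϑ0 hT hsa hρ₀ hρ₀c f.continuous
  let Λ₀ : C_c(ℝ, ℝ) →ₗ[ℝ] ℝ :=
    { toFun := fun f => ∫ D, diagonalSum ϑ T ρ₀ f D ∂μ
      map_add' := fun f f' => by
        rw [← integral_add (hint f) (hint f')]
        exact integral_congr_ae (Eventually.of_forall fun D =>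
          diagonalSum_add_right hU hU1 hϑc hϑ0 hρ₀c f.continuous f'.continuous D)
      map_smul' := fun c f => by
        rw [RingHom.id_apply, smul_eq_mul, ← integral_const_mul]
        exact integral_congr_ae (Eventually.of_forall fun D =>
          diagonalSum_const_mul_right f.continuous c D) }
  let Λ : C_c(ℝ, ℝ) →ₚ[ℝ] ℝ := PositiveLinearMap.mk₀ Λ₀ fun f hf =>
    integral_nonneg fun D => diagonalSum_nonneg hρ₀0 (fun t => hf t) D
  refine ⟨RealRMK.rieszMeasure Λ, ⟨inferInstance, fun ρ hρ hρc _ hρ1 φ hφ hφc => ?_⟩, ?_⟩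
  · rw [pasturShubin_eq_integral_diagonalSum]
    obtain ⟨c, hc⟩ := integral_diagonalSum_eq m hU hU1 hD hϑ hϑc hϑ0 hT hsa hφ hμ
    have h := RealRMK.integral_rieszMeasure Λ ⟨⟨φ, hφ⟩, hφc⟩
    have h' : ∫ t, φ t ∂(RealRMK.rieszMeasure Λ) = ∫ D, diagonalSum ϑ T ρ₀ φ D ∂μ := h
    rw [h', hc ρ hρ hρc, hc ρ₀ hρ₀ hρ₀c, hρ1, hρ₀1]
  · intro η hη
    -- A locally finite measure on `ℝ` is regular, hence determined by its integrals over `C_c(ℝ)`;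
    -- the formula for the single `ρ₀` prescribes these.
    have := hη.isRadon
    refine Measure.ext_of_integral_eq_on_compactlySupported fun f => ?_
    have h := hη.formula ρ₀ hρ₀ hρ₀c hρ₀0 hρ₀1 f f.continuous f.hasCompactSupport
    rw [pasturShubin_eq_integral_diagonalSum] at h
    rw [RealRMK.integral_rieszMeasure]
    exact Complex.ofReal_injective h

end Existence

/-! ### Convergence of invariant measures -/

section Convergence

variable {X : Type*} [Group X] [TopologicalSpace X] [IsTopologicalGroup X] {U K : Set X}

/-- The translation action by homeomorphisms. -/
def DeloneSpace.translateHomeomorph (g : X) : DeloneSpace U K ≃ₜ DeloneSpace U K where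
  toFun := DeloneSpace.translate g
  invFun := DeloneSpace.translate g⁻¹
  left_inv D := Subtype.ext (Subtype.ext (inv_smul_smul g D.1.1))
  right_inv D := Subtype.ext (Subtype.ext (smul_inv_smul g D.1.1))
  continuous_toFun := DeloneSpace.continuous_translate g
  continuous_invFun := DeloneSpace.continuous_translate g⁻¹

/-- If closed sets `F l` converge to `F`, then limits of finite measures concentrated on `F l`
are concentrated on `F`. -/
theorem measure_compl_eq_zero_of_tendsto {Z ι : Type*} [TopologicalSpace Z] [T2Space Z]
    [CompactSpace Z] [MeasurableSpace Z] [BorelSpace Z] {l : Filter ι} [l.NeBot]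
    {F : ι → FellSpace Z} {F₀ : FellSpace Z} (hF : Tendsto F l (𝓝 F₀)) {μ : ι → Measure Z}
    (hμ : ∀ i, μ i (F i).1ᶜ = 0) {ν : Measure Z} [ν.Regular] [IsFiniteMeasure ν]
    (hν : ∀ f : BoundedContinuousFunction Z ℝ,
      Tendsto (fun i => ∫ z, f z ∂(μ i)) l (𝓝 (∫ z, f z ∂ν))) :
    ν F₀.1ᶜ = 0 := by
  -- By inner regularity it suffices to treat compact `C` off `F₀`. A bump function equal to `1` on
  -- `C` and supported near it has integral zero for `μ i` as soon as `F i` misses the larger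
  -- compact set `C'`.
  rw [F₀.2.isOpen_compl.measure_eq_iSup_isCompact]
  simp only [ENNReal.iSup_eq_zero]
  intro C hCF hC
  obtain ⟨C', hC', hCC', hC'F⟩ := exists_compact_between hC F₀.2.isOpen_compl hCF
  obtain ⟨f, hf1, hf0, -, hf⟩ := exists_continuous_one_zero_of_isCompact hC
    isOpen_interior.isClosed_compl (disjoint_compl_right_iff_subset.2 hCC')
  have hev : ∀ᶠ i in l, ∫ z, f z ∂(μ i) = 0 := by
    have hmiss := (FellSpace.tendsto_nhds_iff.1 hF).1 C' hC'
      (eq_empty_iff_forall_notMem.2 fun z hz => hC'F hz.2 hz.1)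
    filter_upwards [hmiss] with i hi
    refine integral_eq_zero_of_ae (measure_mono_null ?_ (hμ i))
    intro z hz hzF
    refine hz (hf0 fun hzC => ?_)
    exact (eq_empty_iff_forall_notMem.1 hi z) ⟨hzF, interior_subset hzC⟩
  have h0 : ∫ z, f z ∂ν = 0 := by
    refine tendsto_nhds_unique (hν (BoundedContinuousFunction.mkOfCompact f)) ?_
    exact tendsto_const_nhds.congr' (hev.mono fun i hi => hi.symm)
  have hint : Integrable f ν :=
    f.continuous.integrable_of_hasCompactSupport (HasCompactSupport.of_compactSpace _)
  rw [integral_eq_zero_iff_of_nonneg (fun z => (hf z).1) hint] at h0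
  refine measure_mono_null ?_ h0
  intro z hz hz0
  have h1 := hf1 hz
  change f z = 0 at hz0
  rw [hz0] at h1
  exact zero_ne_one h1

end Convergence

section UniqueErgodicity

variable {G H : Type*} [Group G] [TopologicalSpace G] [IsTopologicalGroup G]
  [Group H] [TopologicalSpace H] [IsTopologicalGroup H] {U K : Set (G × H)}
  [T2Space (DeloneSpace U K)] [CompactSpace (DeloneSpace U K)]

/-- Invariant measures on systems that converge to a uniquely ergodic system converge weakly. -/
theorem IsUniquelyErgodicWith.tendsto_integral {Ω : FellSpace (DeloneSpace U K)}
    {μ : Measure (DeloneSpace U K)} (hμ : IsUniquelyErgodicWith Ω μ)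
    {Ωl : ℕ → FellSpace (DeloneSpace U K)} {μl : ℕ → Measure (DeloneSpace U K)}
    (hμl : ∀ l, IsInvariantProbability (Ωl l) (μl l)) (hlim : Tendsto Ωl atTop (𝓝 Ω))
    {f : DeloneSpace U K → ℝ} (hf : Continuous f) :
    Tendsto (fun l => ∫ D, f D ∂(μl l)) atTop (𝓝 (∫ D, f D ∂μ)) := by
  -- Along an ultrafilter compactness of the space of probability measures gives an actual limit, so
  -- no metrizability or subsequences are needed.
  rw [tendsto_iff_ultrafilter]
  intro 𝒰 h𝒰
  let P : ℕ → ProbabilityMeasure (DeloneSpace U K) := fun l => ⟨μl l, (hμl l).isProbability⟩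
  obtain ⟨ν₀, -, hν₀⟩ := isCompact_univ.ultrafilter_le_nhds (𝒰.map P) (by simp)
  have hconv := ProbabilityMeasure.tendsto_iff_forall_integral_tendsto.1
    (show Tendsto P 𝒰 (𝓝 ν₀) from hν₀)
  -- The limit is replaced by a regular measure with the same integrals of continuous functions,
  -- since the support and invariance arguments both use regularity.
  obtain ⟨ν, hνr, hνf, hν⟩ := Measure.exists_regular_eq_of_compactSpace
    (ν₀ : Measure (DeloneSpace U K))
  simp only [hν] at hconv
  have hconv' : ∀ f : BoundedContinuousFunction (DeloneSpace U K) ℝ,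
      Tendsto (fun l => ∫ D, f D ∂(μl l)) 𝒰 (𝓝 (∫ D, f D ∂ν)) := hconv
  have hinv : IsInvariantProbability Ω ν := by
    refine ⟨⟨?_⟩, ?_, fun g => ?_⟩
    · have h := hν (BoundedContinuousFunction.const _ 1)
      simp only [BoundedContinuousFunction.const_apply, integral_const, probReal_univ,
        smul_eq_mul, mul_one] at h
      rw [← ENNReal.toReal_eq_one_iff]
      exact h.symm
    · exact measure_compl_eq_zero_of_tendsto (hlim.mono_left h𝒰)
        (fun l => (hμl l).concentrated) hconv'
    · have : (Measure.map (fun D => D.translate (g, (1 : H))) ν).Regular :=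
        Measure.Regular.map (DeloneSpace.translateHomeomorph (g, (1 : H)))
      refine Measure.ext_of_integral_eq_on_compactlySupported fun φ => ?_
      have hc := DeloneSpace.continuous_translate (U := U) (K := K) (g, (1 : H))
      have hmap : ∀ κ : Measure (DeloneSpace U K),
          ∫ D, φ D ∂(κ.map fun D => D.translate (g, (1 : H))) =
            ∫ D, φ (D.translate (g, (1 : H))) ∂κ := fun κ =>
        (DeloneSpace.translateHomeomorph (g, (1 : H))).measurableEmbedding.integral_map
          (φ : DeloneSpace U K → ℝ)
      rw [hmap]
      have h1 := hconv' (BoundedContinuousFunction.mkOfCompact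
        ⟨fun D => φ (D.translate (g, (1 : H))), φ.continuous.comp hc⟩)
      have h2 := hconv' (BoundedContinuousFunction.mkOfCompact φ.toContinuousMap)
      refine tendsto_nhds_unique h1 (h2.congr fun l => ?_)
      change ∫ D, φ D ∂(μl l) = ∫ D, φ (D.translate (g, (1 : H))) ∂(μl l)
      rw [← hmap, (hμl l).invariant g]
  have h := hconv' (BoundedContinuousFunction.mkOfCompact ⟨f, hf⟩)
  rw [hμ.2 ν hinv] at h
  exact h

end UniqueErgodicity

end DeloneDOS

end

/-! ### The main theorem. -/

theorem theorem5p8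
    {G H : Type*}
    [Group G] [TopologicalSpace G] [IsTopologicalGroup G] [LocallyCompactSpace G]
    [SecondCountableTopology G] [T2Space G] [MeasurableSpace G] [BorelSpace G]
    [Group H] [TopologicalSpace H] [IsTopologicalGroup H] [LocallyCompactSpace H]
    [SecondCountableTopology H] [T2Space H] [MeasurableSpace H] [BorelSpace H]
    -- a Haar measure of the unimodular group `G`
    (m : Measure G) [m.IsHaarMeasure] [m.IsMulRightInvariant]
    -- the parameters of the Delone sets
    (U K : Set (G × H)) (hU : IsOpen U) (hU1 : (1 : G × H) ∈ U) (hK : IsCompact K)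
    -- the continuous window function
    (ϑ : H → ℝ) (hϑ : Continuous ϑ) (hϑc : HasCompactSupport ϑ) (hϑ0 : ∀ h, 0 ≤ ϑ h)
    -- the uniquely ergodic limit system
    (Ω : FellSpace (DeloneSpace U K)) (hΩ : IsInvariantSystem Ω)
    (μ : Measure (DeloneSpace U K)) (hμ : IsUniquelyErgodicWith Ω μ)
    -- the approximating systems
    (Ωl : ℕ → FellSpace (DeloneSpace U K)) (hΩl : ∀ l, IsInvariantSystem (Ωl l))
    (μl : ℕ → Measure (DeloneSpace U K)) (hμl : ∀ l, IsInvariantProbability (Ωl l) (μl l))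
    (hlim : Tendsto Ωl atTop (𝓝 Ω))
    -- the self-adjoint random bounded operator
    (A : ∀ D : DeloneSpace U K, WeightedL2 ϑ D →L[ℂ] WeightedL2 ϑ D)
    (hA : IsRandomBoundedOperator ϑ A) (hAsa : ∀ D, IsSelfAdjoint (A D)) :
    -- the densities of states are well defined, and they converge in the weak-* topology
    (∃! η : Measure ℝ, IsDensityOfStates m ϑ A μ η) ∧
    (∀ l, ∃! ηl : Measure ℝ, IsDensityOfStates m ϑ A (μl l) ηl) ∧
    ∀ (η : Measure ℝ) (ηl : ℕ → Measure ℝ), IsDensityOfStates m ϑ A μ η →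
      (∀ l, IsDensityOfStates m ϑ A (μl l) (ηl l)) →
      ∀ φ : ℝ → ℝ, Continuous φ → HasCompactSupport φ →
        Tendsto (fun l => ∫ t, φ t ∂(ηl l)) atTop (𝓝 (∫ t, φ t ∂η)) := by
  have hcomp : CompactSpace (DeloneSpace U K) := DeloneSpace.compactSpace hU hK
  have hD : ∀ D : DeloneSpace U K, D.carrier.Countable :=
    DeloneSpace.countable_carrier hU hU1
  have hprob := hμ.1.isProbability
  have hprobl := fun l => (hμl l).isProbability
  refine ⟨existsUnique_isDensityOfStates m hU hU1 hD hϑ hϑc hϑ0 hA hAsa hμ.1.invariant,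
    fun l => existsUnique_isDensityOfStates m hU hU1 hD hϑ hϑc hϑ0 hA hAsa (hμl l).invariant,
    fun η ηl hη hηl φ hφ hφc => ?_⟩
  -- One `ρ` is used for all the measures, so that all the densities of states test the same
  -- continuous function.
  obtain ⟨ρ, hρ, hρc, hρ0, hρ1⟩ := exists_integral_eq_one m
  have h : ∀ (ν : Measure (DeloneSpace U K)) (ξ : Measure ℝ), IsDensityOfStates m ϑ A ν ξ →
      ∫ t, φ t ∂ξ = ∫ D, diagonalSum ϑ A ρ φ D ∂ν := by
    intro ν ξ hξ
    have := hξ.formula ρ hρ hρc hρ0 hρ1 φ hφ hφc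
    rw [pasturShubin_eq_integral_diagonalSum] at this
    exact Complex.ofReal_injective this
  rw [h μ η hη]
  simp only [fun l => h (μl l) (ηl l) (hηl l)]
  exact hμ.tendsto_integral hμl hlim
    (continuous_diagonalSum hU hU1 hD hϑ hϑc hϑ0 hA hAsa hρ hρc hφ)
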